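/- Consider $N$ players; player $i$ chooses actions in $\mathbb R^{d_i}$ and has a loss $\ell^i(x)$ of the joint action $x=(x^1,\dots,x^N)$ which is convex and differentiable in $x^i$. Write $V^i(x)=\nabla_{x^i}\ell^i(x)$ and assume that every $V^i$ is $L$-Lipschitz on the joint action space and bounded, $\|V^i(x)\|\le G$. Assume that the game is variationally stable: the set of Nash equilibria is non-empty and $\sum_i\langle V^i(x),x^i-z^i\rangle\ge 0$ for every joint action $x$ and every Nash equilibrium $z$. In every round $t\ge 1$ a joint action $x_t$ is played and player $i$ receives $g_t^i=V^i(x_t)+\xi_t^i$. With $\mathcal F_t=\sigma(x_1,\dots,x_t)$, the noise satisfies $\mathbb E[\xi_t^i\mid\mathcal F_t]=0$ and $\|\xi_t^i\|\le\sigma$ almost surely. All players run OptDA+ from a deterministic point $X_1$: with $g_0^i=0$, $$x_t^i=X_t^i-\eta_t^i\,g_{t-1}^i,\qquad X_{t+1}^i=X_1^i-\gamma_{t+1}^i\sum_{s=1}^{t}g_s^i ,$$ with the adaptive learning rates $$\eta_t^i=\Big(1+\sum_{s=1}^{t-2}\|g_s^i\|^2\Big)^{-(1/2-q)},\qquad \gamma_t^i=\Big(1+\sum_{s=1}^{t-2}\big(\|g_s^i\|^2+\|X_s^i-X_{s+1}^i\|^2\big)\Big)^{-1/2},\qquad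 q\in(0,1/4].$$ For a comparator $p\in\mathbb R^{d_i}$ let $\mathrm{Reg}_T^i(p)=\sum_{t=1}^T\big(\ell^i(x_t)-\ell^i(p,x_t^{-i})\big)$ be the regret and $\mathrm{LinReg}_T^i(p)=\sum_{t=1}^T\langle V^i(x_t),x_t^i-p\rangle$ the linearized regret of player $i$. Let $i$ be a player and $\mathcal P^i\subset\mathbb R^{d_i}$ a bounded set. All constants below depend on the game, $X_1$, $\mathcal P^i$, $\sigma$ (and, in (b), $\sigma_M$), but neither on $T$ nor on $q$ nor on the law of the noise. (a) (Additive noise.) There is a constant $C$ such that, for all $T$, $$\sup_{p\in\mathcal P^i}\mathbb E[\mathrm{LinReg}_T^i(p)]\le C\sqrt T\quad\text{and}\quad \sup_{p\in\mathcal P^i}\mathbb E[\mathrm{Reg}_T^i(p)]\le C\sqrt T .$$ (b) (Multiplicative noise.) If in addition $\mathbb E[\|\xi_t^i\|^2\mid\mathcal F_t]\le\sigma_M^2\|V^i(x_t)\|^2$ almost surely for all players $i$ and all $t\ge1$, then the regret is bounded by a constant that is at most exponential in $1/(2q)$: there are constants $A,B$ such that, for all $T$, $$\mathbb E\Big[\sup_{p\in\mathcal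 P^i}\mathrm{LinReg}_T^i(p)\Big]\le A\,e^{B/(2q)}\quad\text{and}\quad \mathbb E\Big[\sup_{p\in\mathcal P^i}\mathrm{Reg}_T^i(p)\Big]\le A\,e^{B/(2q)} .$$ All these expectations are well defined. -/

import Mathlib

open MeasureTheory
open scoped NNReal InnerProductSpace

namespace NoisyGame

noncomputable section

/-- Action profiles of `N` players, player `i` acting in `ℝ^(d i)`; the norm is the Euclidean norm
of the product space. -/
abbrev Profile {N : ℕ} (d : Fin N → ℕ) : Type :=
  PiLp 2 (fun i => EuclideanSpace ℝ (Fin (d i)))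

/-- The profile `(y, x^{-i})`. -/
def deviate {N : ℕ} {d : Fin N → ℕ} (x : Profile d) (i : Fin N)
    (y : EuclideanSpace ℝ (Fin (d i))) : Profile d :=
  WithLp.toLp 2 (Function.update (WithLp.ofLp x) i y)

/-- The individual gradient `V^i(x) = ∇_{x^i} ℓ^i(x)`. -/
def grad {N : ℕ} {d : Fin N → ℕ} (ℓ : Fin N → Profile d → ℝ) (i : Fin N) (x : Profile d) :
    EuclideanSpace ℝ (Fin (d i)) :=
  gradient (fun y => ℓ i (deviate x i y)) (x i)

/-- Each loss is convex and differentiable in the action of its player, and each individual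
gradient is `L`-Lipschitz on the joint action space. -/
structure IsSmoothConvexGame {N : ℕ} {d : Fin N → ℕ} (ℓ : Fin N → Profile d → ℝ) (L : ℝ≥0) :
    Prop where
  convex : ∀ i x, ConvexOn ℝ Set.univ (fun y => ℓ i (deviate x i y))
  differentiable : ∀ i x, Differentiable ℝ (fun y => ℓ i (deviate x i y))
  lipschitz : ∀ i, LipschitzWith L (grad ℓ i)

/-- Nash equilibria. -/
def IsNash {N : ℕ} {d : Fin N → ℕ} (ℓ : Fin N → Profile d → ℝ) (z : Profile d) : Prop :=
  ∀ i y, ℓ i z ≤ ℓ i (deviate z i y)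

/-- Variational stability. -/
structure IsVariationallyStable {N : ℕ} {d : Fin N → ℕ} (ℓ : Fin N → Profile d → ℝ) : Prop where
  exists_nash : ∃ z, IsNash ℓ z
  stable : ∀ x z, IsNash ℓ z → 0 ≤ ∑ i, ⟪grad ℓ i x, x i - z i⟫_ℝ

/-- The extrapolation rate of player `i` at round `t`:
`(1 + ∑_{s=1}^{t-2} ‖g_s^i‖²)^{-(1/2-q)}`.
(The truncated subtraction `t - 2` makes the sum empty for `t ≤ 2`.) -/
def extrapolationRate {N : ℕ} {d : Fin N → ℕ} (q : ℝ) (g : ℕ → Profile d) (t : ℕ) (i : Fin N) :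
    ℝ :=
  (1 + ∑ s ∈ Finset.Icc 1 (t - 2), ‖g s i‖ ^ 2) ^ (-(1 / 2 - q))

/-- The update rate of player `i` at round `t`:
`(1 + ∑_{s=1}^{t-2} (‖g_s^i‖² + ‖X_s^i - X_{s+1}^i‖²))^{-1/2}`. -/
def updateRate {N : ℕ} {d : Fin N → ℕ} (g X : ℕ → Profile d) (t : ℕ) (i : Fin N) : ℝ :=
  (1 + ∑ s ∈ Finset.Icc 1 (t - 2), (‖g s i‖ ^ 2 + ‖X s i - X (s + 1) i‖ ^ 2)) ^ (-(1 / 2 : ℝ))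

/-- One trajectory of the game in which all players run adaptive OptDA+ from the profile `X₁`,
with noise sequence `ξ`. Rounds are numbered from `1`; `x t` is the profile played in round `t`
(that is, `X_{t+1/2}`), `g t` the feedback received in round `t`, and `X t` the base iterate.
The values of `ξ`, `X`, `x` at index `0` play no role. -/
structure IsAdaptiveOptDAPlus {N : ℕ} {d : Fin N → ℕ} (ℓ : Fin N → Profile d → ℝ) (q : ℝ)
    (X₁ : Profile d) (ξ X x g : ℕ → Profile d) : Prop where
  init : X 1 = X₁
  feedback_zero : g 0 = 0
  play : ∀ t, 1 ≤ t → ∀ i, x t i = X t i - extrapolationRate q g t i • g (t - 1) i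
  feedback : ∀ t, 1 ≤ t → ∀ i, g t i = grad ℓ i (x t) + ξ t i
  update : ∀ t, 1 ≤ t → ∀ i,
    X (t + 1) i = X₁ i - updateRate g X (t + 1) i • ∑ s ∈ Finset.Icc 1 t, g s i

/-- The σ-algebra `F_t` generated by the played profiles `x_1, …, x_t`. -/
abbrev playHistory {N : ℕ} {d : Fin N → ℕ} {Ω : Type*} (x : ℕ → Ω → Profile d) (t : ℕ) :
    MeasurableSpace Ω :=
  ⨆ s ∈ Set.Icc 1 t, MeasurableSpace.comap (x s) inferInstance

/-- The noise is conditionally unbiased given the history of play, and almost surely bounded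
by `σ`. -/
structure IsUnbiasedBoundedNoise {N : ℕ} {d : Fin N → ℕ} {Ω : Type*} [MeasurableSpace Ω]
    (μ : Measure Ω) (ξ x : ℕ → Ω → Profile d) (σ : ℝ) : Prop where
  measurable : ∀ t, 1 ≤ t → Measurable (ξ t)
  unbiased : ∀ t, 1 ≤ t → ∀ i, μ[fun ω => ξ t ω i | playHistory x t] =ᵐ[μ] 0
  bounded : ∀ t, 1 ≤ t → ∀ i, ∀ᵐ ω ∂μ, ‖ξ t ω i‖ ≤ σ

/-- Conditional variance control `E[‖ξ_t^i‖² | F_t] ≤ σA² + σM² ‖V^i(x_t)‖²`. The noise is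
multiplicative when this holds with `σA = 0`. -/
def HasVarianceControl {N : ℕ} {d : Fin N → ℕ} {Ω : Type*} [MeasurableSpace Ω]
    (μ : Measure Ω) (ℓ : Fin N → Profile d → ℝ) (ξ x : ℕ → Ω → Profile d) (σA σM : ℝ) : Prop :=
  ∀ t, 1 ≤ t → ∀ i, μ[fun ω => ‖ξ t ω i‖ ^ 2 | playHistory x t]
    ≤ᵐ[μ] fun ω => σA ^ 2 + σM ^ 2 * ‖grad ℓ i (x t ω)‖ ^ 2

/-- Regret of player `i` after `T` rounds with respect to the comparator `p`. -/
def regret {N : ℕ} {d : Fin N → ℕ} (ℓ : Fin N → Profile d → ℝ) (i : Fin N) (x : ℕ → Profile d)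
    (T : ℕ) (p : EuclideanSpace ℝ (Fin (d i))) : ℝ :=
  ∑ t ∈ Finset.Icc 1 T, (ℓ i (x t) - ℓ i (deviate (x t) i p))

/-- Linearized regret of player `i` after `T` rounds with respect to the comparator `p`. -/
def linRegret {N : ℕ} {d : Fin N → ℕ} (ℓ : Fin N → Profile d → ℝ) (i : Fin N)
    (x : ℕ → Profile d) (T : ℕ) (p : EuclideanSpace ℝ (Fin (d i))) : ℝ :=
  ∑ t ∈ Finset.Icc 1 T, ⟪grad ℓ i (x t), x t i - p⟫_ℝ

/-- `max_{p ∈ P} E[R p] ≤ c`, all the expectations being well defined. -/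
def SupExpectationLE {Ω E : Type*} [MeasurableSpace Ω] (μ : Measure Ω) (P : Set E)
    (R : E → Ω → ℝ) (c : ℝ) : Prop :=
  ∀ p ∈ P, Integrable (R p) μ ∧ ∫ ω, R p ω ∂μ ≤ c

/-- `E[max_{p ∈ P} R p] ≤ c`, the supremum being finite and integrable. -/
def ExpectationSupLE {Ω E : Type*} [MeasurableSpace Ω] (μ : Measure Ω) (P : Set E)
    (R : E → Ω → ℝ) (c : ℝ) : Prop :=
  (∀ ω, BddAbove (Set.range fun p : P => R p ω)) ∧
    Integrable (fun ω => ⨆ p : P, R p ω) μ ∧ ∫ ω, ⨆ p : P, R p ω ∂μ ≤ c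

end

end NoisyGame

/-!
The regret of one player is bounded by that of optimistic dual averaging: an initial term
proportional to the last inverse update rate `1 / γ`, plus `∑ γ_t ‖g_t‖²` and the variation of the
gradients, minus the weighted path length of the iterates, minus the extrapolation gain
`∑ η_{t+1} ‖V_t‖²`, plus a noise term of mean zero. With the adaptive rates the positive terms are,
up to a constant, of the order of `√E` with `E = 1 + ∑ ‖g_t‖²`, because the path length absorbs
those that depend on the iterates.

For an equilibrium as comparator, variational stability makes the regrets of all players add up to
a nonnegative number. Hence the expected path lengths and extrapolation gains are at most of the
order of the expected `√E`, summed over the players, and so is the regret of a single player for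
any comparator. Always `E = O(T)`, which gives `√T`. Under multiplicative noise the expected
extrapolation gain dominates the expectation of `∑ η_{t+1} ‖g_t‖²`, hence of `E ^ (1 / 2 + q)`;
comparing this with `√E` bounds the expected `√E` by a constant exponential in `1 / (2q)`.

The comparator meets the noise only in the inner product with `∑ ξ_t`, so taking the supremum over
comparators before the expectation costs a multiple of `‖∑ ξ_t‖`. Dividing `‖∑ ξ_t‖²` by `√E` along
the rounds bounds this norm by a multiple of `√E` plus a term of mean zero.
-/

namespace NoisyGame

/-! ### Delayed sums of nonnegative sequences -/

lemma sum_Icc_eq_sum_Ico_succ {M : Type*} [AddCommMonoid M] {f : ℕ → M} (hf : f 1 = 0) (T : ℕ) :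
    ∑ t ∈ Finset.Icc 1 T, f t = ∑ s ∈ Finset.Ico 1 T, f (s + 1) := by
  induction T with
  | zero => simp
  | succ n ih =>
    rw [Finset.sum_Icc_succ_top (by lia), ih]
    rcases n with _ | n
    · simpa using hf
    · exact (Finset.sum_Ico_succ_top (by lia) fun s => f (s + 1)).symm

lemma sum_Icc_le_sum_Icc_sub_add {a : ℕ → ℝ} {B : ℝ} (hB : 0 ≤ B) (haB : ∀ t, 1 ≤ t → a t ≤ B)
    (t k : ℕ) : ∑ s ∈ Finset.Icc 1 t, a s ≤ ∑ s ∈ Finset.Icc 1 (t - k), a s + k * B := by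
  induction k with
  | zero => simp
  | succ k ih =>
    suffices h : ∑ s ∈ Finset.Icc 1 (t - k), a s ≤ ∑ s ∈ Finset.Icc 1 (t - (k + 1)), a s + B by
      push_cast; linarith
    rw [← Nat.sub_sub]
    rcases t - k with _ | m
    · simpa using hB
    · rw [Finset.sum_Icc_succ_top (by lia), Nat.add_sub_cancel]
      gcongr
      exact haB _ (by lia)

/-- The cumulated sum `1 + ∑_{s=1}^t a_s` whose negative powers are the adaptive learning rates. -/
noncomputable def cumul (a : ℕ → ℝ) (t : ℕ) : ℝ := 1 + ∑ s ∈ Finset.Icc 1 t, a s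

lemma cumul_succ (a : ℕ → ℝ) (t : ℕ) : cumul a (t + 1) = cumul a t + a (t + 1) := by
  rw [cumul, cumul, Finset.sum_Icc_succ_top (by lia), add_assoc]

section Cumul

variable {a : ℕ → ℝ} {B : ℝ}

lemma cumul_mono (ha : ∀ t, 0 ≤ a t) : Monotone (cumul a) :=
  monotone_nat_of_le_succ fun t => by rw [cumul_succ]; linarith [ha (t + 1)]

lemma one_le_cumul (ha : ∀ t, 0 ≤ a t) (t : ℕ) : 1 ≤ cumul a t :=
  le_add_of_nonneg_right (Finset.sum_nonneg fun s _ => ha s)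

lemma cumul_pos (ha : ∀ t, 0 ≤ a t) (t : ℕ) : 0 < cumul a t :=
  one_pos.trans_le (one_le_cumul ha t)

lemma cumul_le_mul_cumul_sub_two (ha : ∀ t, 0 ≤ a t) (haB : ∀ t, 1 ≤ t → a t ≤ B) (t : ℕ) :
    cumul a t ≤ (1 + 2 * B) * cumul a (t - 2) := by
  have hB : 0 ≤ B := (ha 1).trans (haB 1 le_rfl)
  have hdelay := sum_Icc_le_sum_Icc_sub_add hB haB t 2
  have hone := one_le_cumul ha (t - 2)
  rw [cumul] at hone ⊢
  push_cast at hdelay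
  rw [cumul]
  nlinarith

/-- Since `√(S_t) - √(S_{t-1}) ≥ a_t / (2 √(S_t))`, the sum telescopes up to the effect of the
delay, which is the factor `√(1 + 2B)`. -/
lemma sum_div_sqrt_cumul_le (ha : ∀ t, 0 ≤ a t) (haB : ∀ t, 1 ≤ t → a t ≤ B) (T : ℕ) :
    ∑ t ∈ Finset.Icc 1 T, a t / √(cumul a (t - 2)) ≤ 2 * √(1 + 2 * B) * √(cumul a T) := by
  have hB : 0 ≤ B := (ha 1).trans (haB 1 le_rfl)
  induction T with
  | zero => simp only [Finset.Icc_eq_empty_of_lt zero_lt_one, Finset.sum_empty]; positivity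
  | succ n ih =>
    rw [Finset.sum_Icc_succ_top (by lia)]
    set κ := √(1 + 2 * B)
    set v := √(cumul a (n + 1))
    set u := √(cumul a n)
    set w := √(cumul a (n + 1 - 2))
    have hw : 0 < w := Real.sqrt_pos.2 (cumul_pos ha _)
    have huv : u ≤ v := Real.sqrt_le_sqrt (cumul_mono ha n.le_succ)
    have hvw : v ≤ κ * w := by
      rw [← Real.sqrt_mul (by positivity)]
      exact Real.sqrt_le_sqrt (cumul_le_mul_cumul_sub_two ha haB _)
    have hsq : a (n + 1) = v ^ 2 - u ^ 2 := by
      rw [Real.sq_sqrt (cumul_pos ha _).le, Real.sq_sqrt (cumul_pos ha _).le, cumul_succ]; ring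
    have hterm : a (n + 1) / w ≤ 2 * κ * (v - u) := by
      rw [div_le_iff₀ hw, hsq]
      nlinarith [mul_nonneg (sub_nonneg.2 huv) (sub_nonneg.2 hvw)]
    linarith

lemma rpow_cumul_le_sum_add {q : ℝ} (ha : ∀ t, 0 ≤ a t) (haB : ∀ t, 1 ≤ t → a t ≤ B)
    (hq : q ≤ 1 / 2) (T : ℕ) :
    cumul a T ^ (1 / 2 + q) ≤
      ∑ s ∈ Finset.Ico 1 T, cumul a (s - 1) ^ (-(1 / 2 - q)) * a s + (1 + B) := by
  have hB : 0 ≤ B := (ha 1).trans (haB 1 le_rfl)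
  set U := cumul a T with hU
  set c := U ^ (-(1 / 2 - q)) with hc
  have hU1 : 1 ≤ U := one_le_cumul ha _
  have hU0 : 0 < U := one_pos.trans_le hU1
  have hc1 : c ≤ 1 := Real.rpow_le_one_of_one_le_of_nonpos hU1 (by linarith)
  have hc0 : 0 < c := Real.rpow_pos_of_pos hU0 _
  have hsum : c * ∑ s ∈ Finset.Ico 1 T, a s ≤
      ∑ s ∈ Finset.Ico 1 T, cumul a (s - 1) ^ (-(1 / 2 - q)) * a s := by
    rw [Finset.mul_sum]
    refine Finset.sum_le_sum fun s hs => mul_le_mul_of_nonneg_right ?_ (ha s)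
    have hsT := (Finset.mem_Ico.1 hs).2
    exact Real.rpow_le_rpow_of_nonpos (cumul_pos ha _) (cumul_mono ha (by lia)) (by linarith)
  have hlast : U ≤ ∑ s ∈ Finset.Ico 1 T, a s + (1 + B) := by
    rw [hU]
    rcases T with _ | n
    · simpa [cumul] using hB
    · rw [cumul_succ, cumul, Finset.Ico_add_one_right_eq_Icc]
      linarith [haB (n + 1) (by lia)]
  calc U ^ (1 / 2 + q) = c * U := by rw [hc, ← Real.rpow_add_one hU0.ne']; congr 1; ring
    _ ≤ c * ∑ s ∈ Finset.Ico 1 T, a s + c * (1 + B) := by rw [← mul_add]; gcongr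
    _ ≤ _ := add_le_add hsum (mul_le_of_le_one_left (by linarith) hc1)

end Cumul

/-- The negative terms take over once `lam t ≥ K / c`; until then the truncated sum stays below
`(K / c) ^ 2 + 2`, because `lam t` is at least the root of that sum two rounds earlier. -/
lemma sum_mul_min_one_sub_le {b lam : ℕ → ℝ} {c K : ℝ} (hb : ∀ t, 0 ≤ b t) (hc : 0 < c)
    (hK : 0 ≤ K) (hlam : ∀ t, √(∑ s ∈ Finset.Icc 1 (t - 2), b s) ≤ lam t) (T : ℕ) :
    ∑ t ∈ Finset.Icc 1 T, (K * min 1 (b t) - c * (lam t * b t)) ≤ K * ((K / c) ^ 2 + 2) := by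
  set D : ℕ → ℝ := fun t => ∑ s ∈ Finset.Icc 1 t, min 1 (b s) with hD
  set cap := (K / c) ^ 2 + 2
  have hm : ∀ t, 0 ≤ min 1 (b t) := fun t => le_min zero_le_one (hb t)
  have hD_succ : ∀ t, D (t + 1) = D t + min 1 (b (t + 1)) := fun t =>
    Finset.sum_Icc_succ_top (by lia) _
  have hD_delay : ∀ t, D t ≤ D (t - 2) + 2 := fun t => by
    simpa using sum_Icc_le_sum_Icc_sub_add zero_le_one (fun s _ => min_le_left 1 (b s)) t 2
  suffices h : ∑ t ∈ Finset.Icc 1 T, (K * min 1 (b t) - c * (lam t * b t)) ≤ K * min (D T) cap from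
    h.trans (mul_le_mul_of_nonneg_left (min_le_right _ _) hK)
  induction T with
  | zero =>
    have hcap0 : 0 ≤ cap := by positivity
    simp [hD, hcap0]
  | succ n ih =>
    rw [Finset.sum_Icc_succ_top (by lia)]
    have hlam0 : 0 ≤ lam (n + 1) := (Real.sqrt_nonneg _).trans (hlam (n + 1))
    by_cases hsmall : c * lam (n + 1) < K
    · have hlamK : lam (n + 1) ≤ K / c := by rw [le_div_iff₀ hc]; linarith
      have hsum : D (n + 1 - 2) ≤ (K / c) ^ 2 :=
        (Finset.sum_le_sum fun s _ => min_le_right _ _).trans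
          ((Real.sqrt_le_left (hlam0.trans hlamK)).1 ((hlam (n + 1)).trans hlamK))
      rw [min_eq_left (show D (n + 1) ≤ cap by linarith [hD_delay (n + 1)]), hD_succ]
      have hmin : K * min (D n) cap ≤ K * D n := by gcongr; exact min_le_left _ _
      have hneg : 0 ≤ c * (lam (n + 1) * b (n + 1)) := by have := hb (n + 1); positivity
      linarith
    · have hround : K * min 1 (b (n + 1)) ≤ c * (lam (n + 1) * b (n + 1)) := by
        rw [← mul_assoc]
        exact mul_le_mul (not_lt.1 hsmall) (min_le_right _ _) (hm _) (by positivity)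
      have hmono : K * min (D n) cap ≤ K * min (D (n + 1)) cap := by
        gcongr
        linarith [hD_succ n, hm (n + 1)]
      linarith

/-- Either `U ^ q ≥ 2K`, and the power absorbs `K √U`, or `U < (2K) ^ (1 / q)`: this is the source
of the exponential dependence on `1 / (2q)`. -/
lemma mul_sqrt_le_rpow_add {K U q : ℝ} (hK : 0 < K) (hU : 0 < U) (hq : 0 < q) :
    K * √U ≤ U ^ (1 / 2 + q) / 2 + K * Real.exp (Real.log (2 * K) * (1 / (2 * q))) := by
  have hsqrt : √U = U ^ (1 / 2 : ℝ) := Real.sqrt_eq_rpow U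
  rw [Real.rpow_add hU, ← hsqrt, ← Real.rpow_def_of_pos (by linarith)]
  rcases le_or_gt (2 * K) (U ^ q) with h | h
  · have hrest : 0 ≤ K * (2 * K) ^ (1 / (2 * q)) := by positivity
    nlinarith [Real.sqrt_nonneg U]
  · have hroot : √U ≤ (2 * K) ^ (1 / (2 * q)) := by
      have := Real.rpow_le_rpow (by positivity) h.le (show 0 ≤ 1 / (2 * q) by positivity)
      rwa [← Real.rpow_mul hU.le, show q * (1 / (2 * q)) = 1 / 2 by field_simp, ← hsqrt] at this
    have hpower : 0 ≤ √U * U ^ q / 2 := by positivity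
    linarith [mul_le_mul_of_nonneg_left hroot hK.le]

/-- The first summand takes care of the indices with `u k ≥ 1`, where `v` is bounded by `A`. -/
lemma le_sum_mul_min_one_add {ι : Type*} {s : Finset ι} {A B v : ℝ} {u w : ι → ℝ} (hA : 0 ≤ A)
    (hB : 0 ≤ B) (hu : ∀ k, 0 ≤ u k) (hw : ∀ k, 0 ≤ w k) (hvA : v ≤ A)
    (hvB : v ≤ B * ∑ k ∈ s, (u k + w k)) :
    v ≤ ∑ k ∈ s, ((A + B) * min 1 (u k) + B * w k) := by
  by_cases h : ∃ k ∈ s, 1 ≤ u k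
  · obtain ⟨k, hk, huk⟩ := h
    calc v ≤ (A + B) * min 1 (u k) + B * w k := by
          rw [min_eq_left huk]; linarith [mul_nonneg hB (hw k)]
      _ ≤ _ := Finset.single_le_sum (f := fun k => (A + B) * min 1 (u k) + B * w k)
          (fun k _ => by have := hw k; have := le_min zero_le_one (hu k); positivity) hk
  · push Not at h
    refine hvB.trans ?_
    rw [Finset.mul_sum]
    refine Finset.sum_le_sum fun k hk => ?_
    rw [min_eq_right (h k hk).le]
    linarith [mul_nonneg hA (hu k)]

/-! ### Optimistic dual averaging -/

section OptimisticDualAveraging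

variable {E : Type*} [SeminormedAddCommGroup E]

lemma sq_norm_add_three_le (a b c : E) :
    ‖a + b + c‖ ^ 2 ≤ 3 * (‖a‖ ^ 2 + ‖b‖ ^ 2 + ‖c‖ ^ 2) := by
  have h := norm_add₃_le (a := a) (b := b) (c := c)
  nlinarith [norm_nonneg (a + b + c), sq_nonneg (‖a‖ - ‖b‖), sq_nonneg (‖b‖ - ‖c‖),
    sq_nonneg (‖a‖ - ‖c‖)]

/-- The negative term produced by optimism in the regret: the sum of `‖V s‖ ^ 2`, weighted with the
extrapolation rate of the following round. -/
def optimisticGain (η : ℕ → ℝ) (V : ℕ → E) (T : ℕ) : ℝ :=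
  ∑ s ∈ Finset.Ico 1 T, η (s + 1) * ‖V s‖ ^ 2

lemma optimisticGain_nonneg {η : ℕ → ℝ} (hη : ∀ t, 0 ≤ η t) (V : ℕ → E) (T : ℕ) :
    0 ≤ optimisticGain η V T :=
  Finset.sum_nonneg fun _ _ => mul_nonneg (hη _) (sq_nonneg _)

variable [InnerProductSpace ℝ E]

lemma inner_le_sq_div_add {c : ℝ} (hc : 0 < c) (a b : E) :
    ⟪a, b⟫_ℝ ≤ ‖a‖ ^ 2 / c + c * ‖b‖ ^ 2 / 4 := by
  have hsq : ‖a‖ ^ 2 / c + c * ‖b‖ ^ 2 / 4 - ‖a‖ * ‖b‖ = (‖a‖ - c * ‖b‖ / 2) ^ 2 / c := by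
    field_simp
    ring
  have hnonneg : 0 ≤ (‖a‖ - c * ‖b‖ / 2) ^ 2 / c := by positivity
  linarith [real_inner_le_norm a b]

/-- Expanding the squares, one round of dual averaging gains exactly
`(lam' - lam) / 2 * ‖a‖ ^ 2`, where `a`, `b`, `c` stand for `X 1 - X (t + 1)`, `X (t + 1) - p` and
`X t - X (t + 1)`. -/
lemma inner_dualAveraging_step_le {lam lam' : ℝ} (hlam : lam ≤ lam') (a b c : E) :
    ⟪lam' • a - lam • (a - c), b⟫_ℝ + lam' / 2 * ‖b‖ ^ 2 + lam / 2 * ‖c‖ ^ 2 +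
      lam / 2 * ‖a + b‖ ^ 2 ≤ lam / 2 * ‖c + b‖ ^ 2 + lam' / 2 * ‖a + b‖ ^ 2 := by
  rw [inner_sub_left, real_inner_smul_left, real_inner_smul_left, inner_sub_left,
    norm_add_sq_real a b, norm_add_sq_real c b]
  nlinarith [mul_nonneg (sub_nonneg.2 hlam) (sq_nonneg ‖a‖)]

lemma sum_inner_dualAveraging_add_le {g X : ℕ → E} {lam : ℕ → ℝ} (hlam : Monotone lam)
    (hX : ∀ t, lam (t + 1) • (X 1 - X (t + 1)) = ∑ s ∈ Finset.Icc 1 t, g s) (p : E) (T : ℕ) :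
    ∑ t ∈ Finset.Icc 1 T, ⟪g t, X (t + 1) - p⟫_ℝ + lam (T + 1) / 2 * ‖X (T + 1) - p‖ ^ 2 +
      ∑ t ∈ Finset.Icc 1 T, lam t / 2 * ‖X t - X (t + 1)‖ ^ 2 ≤
        lam (T + 1) / 2 * ‖X 1 - p‖ ^ 2 := by
  induction T with
  | zero => simp
  | succ n ih =>
    rw [Finset.sum_Icc_succ_top (by lia), Finset.sum_Icc_succ_top (by lia)]
    have hg : g (n + 1) = lam (n + 1 + 1) • (X 1 - X (n + 1 + 1)) -
        lam (n + 1) • (X 1 - X (n + 1 + 1) - (X (n + 1) - X (n + 1 + 1))) := by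
      rw [sub_sub_sub_cancel_right, hX (n + 1), hX n, Finset.sum_Icc_succ_top (by lia),
        add_sub_cancel_left]
    have hstep := inner_dualAveraging_step_le (hlam (n + 1).le_succ) (X 1 - X (n + 1 + 1))
      (X (n + 1 + 1) - p) (X (n + 1) - X (n + 1 + 1))
    rw [Nat.succ_eq_add_one, ← hg, sub_add_sub_cancel, sub_add_sub_cancel] at hstep
    linarith

/-- The terms of the regret of optimistic dual averaging that have mean zero when `ξ` is noise:
`V` are the gradients, `g` the noisy feedback, `x` the actions, `η` the extrapolation rates and `p`
is the comparator. -/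
def optimisticNoise (η : ℕ → ℝ) (V ξ x g : ℕ → E) (p : E) (T : ℕ) : ℝ :=
  ∑ t ∈ Finset.Icc 1 T, ⟪p - x t, ξ t⟫_ℝ -
    ∑ s ∈ Finset.Ico 1 T, η (s + 1) * (⟪g s, ξ (s + 1)⟫_ℝ + ⟪V s, ξ s⟫_ℝ)

lemma optimisticNoise_le_add_norm {η : ℕ → ℝ} {V ξ x g : ℕ → E} {p : E} {ρ : ℝ} (hp : ‖p‖ ≤ ρ)
    (T : ℕ) :
    optimisticNoise η V ξ x g p T ≤
      optimisticNoise η V ξ x g 0 T + ρ * ‖∑ t ∈ Finset.Icc 1 T, ξ t‖ := by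
  have hinner : ⟪p, ∑ t ∈ Finset.Icc 1 T, ξ t⟫_ℝ ≤ ρ * ‖∑ t ∈ Finset.Icc 1 T, ξ t‖ :=
    (real_inner_le_norm _ _).trans (by gcongr)
  simp only [optimisticNoise, inner_sub_left, inner_zero_left, Finset.sum_sub_distrib,
    Finset.sum_const_zero, inner_sum] at hinner ⊢
  linarith

/-- Optimism: consecutive feedbacks `V + ξ` and `V' + ξ'` are correlated through the common part
`‖V‖ ^ 2`, up to the variation `V' - V` of the gradient. -/
lemma neg_mul_inner_succ_le (η : ℝ) (V V' ξ ξ' : E) :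
    -(η * ⟪V' + ξ', V + ξ⟫_ℝ) ≤ (‖V' - V‖ ^ 2 + η ^ 2 * ‖V + ξ‖ ^ 2) / 2 - η * ‖V‖ ^ 2 -
      η * (⟪V + ξ, ξ'⟫_ℝ + ⟪V, ξ⟫_ℝ) := by
  have hcorr : ⟪V' + ξ', V + ξ⟫_ℝ =
      ⟪V' - V, V + ξ⟫_ℝ + ‖V‖ ^ 2 + (⟪V + ξ, ξ'⟫_ℝ + ⟪V, ξ⟫_ℝ) := by
    rw [inner_add_left, inner_sub_left, real_inner_comm (V + ξ) ξ', inner_add_right V V ξ,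
      real_inner_self_eq_norm_sq]
    ring
  have hYoung : -(η * ⟪V' - V, V + ξ⟫_ℝ) ≤ (‖V' - V‖ ^ 2 + η ^ 2 * ‖V + ξ‖ ^ 2) / 2 := by
    have hsq := norm_add_sq_real (V' - V) (η • (V + ξ))
    rw [real_inner_smul_right, norm_smul, mul_pow, Real.norm_eq_abs, sq_abs] at hsq
    linarith [sq_nonneg ‖V' - V + η • (V + ξ)‖]
  rw [hcorr]
  linarith

variable {lam η : ℕ → ℝ} {g V ξ X x : ℕ → E}

lemma inner_extrapolation_eq {t : ℕ} (hx : x t = X t - η t • g (t - 1)) (hg : g t = V t + ξ t)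
    (p : E) :
    ⟪V t, x t - p⟫_ℝ = ⟪g t, X (t + 1) - p⟫_ℝ + ⟪g t, X t - X (t + 1)⟫_ℝ -
      η t * ⟪g t, g (t - 1)⟫_ℝ + ⟪p - x t, ξ t⟫_ℝ := by
  have hV : V t = g t - ξ t := by rw [hg, add_sub_cancel_right]
  have hgap : x t - p = X (t + 1) - p + (X t - X (t + 1)) - η t • g (t - 1) := by rw [hx]; abel
  have hnoise : ⟪p - x t, ξ t⟫_ℝ = -⟪ξ t, x t - p⟫_ℝ := by
    rw [← inner_neg_right, neg_sub, real_inner_comm]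
  rw [hnoise, hV, inner_sub_left, ← real_inner_smul_right, ← inner_add_right, ← inner_sub_right,
    ← hgap, sub_eq_add_neg]

lemma sum_inner_optimisticDualAveraging_le (hlam : Monotone lam) (hlam_pos : ∀ t, 0 < lam t)
    (hg_zero : g 0 = 0) (hx : ∀ t, 1 ≤ t → x t = X t - η t • g (t - 1))
    (hg : ∀ t, 1 ≤ t → g t = V t + ξ t)
    (hX : ∀ t, lam (t + 1) • (X 1 - X (t + 1)) = ∑ s ∈ Finset.Icc 1 t, g s) (p : E) (T : ℕ) :
    ∑ t ∈ Finset.Icc 1 T, ⟪V t, x t - p⟫_ℝ ≤ lam (T + 1) / 2 * ‖X 1 - p‖ ^ 2 +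
      (∑ t ∈ Finset.Icc 1 T, ‖g t‖ ^ 2 / lam t -
        (∑ t ∈ Finset.Icc 1 T, lam t * ‖X t - X (t + 1)‖ ^ 2) / 4) +
      (∑ s ∈ Finset.Ico 1 T, ‖V (s + 1) - V s‖ ^ 2 +
        ∑ s ∈ Finset.Ico 1 T, η (s + 1) ^ 2 * ‖g s‖ ^ 2) / 2 -
      optimisticGain η V T + optimisticNoise η V ξ x g p T := by
  have hround : ∀ t ∈ Finset.Icc 1 T, ⟪V t, x t - p⟫_ℝ ≤ ⟪g t, X (t + 1) - p⟫_ℝ +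
      (‖g t‖ ^ 2 / lam t + lam t * ‖X t - X (t + 1)‖ ^ 2 / 4) + -(η t * ⟪g t, g (t - 1)⟫_ℝ) +
      ⟪p - x t, ξ t⟫_ℝ := fun t ht => by
    have ht1 := (Finset.mem_Icc.1 ht).1
    rw [inner_extrapolation_eq (hx t ht1) (hg t ht1)]
    linarith [inner_le_sq_div_add (hlam_pos t) (g t) (X t - X (t + 1))]
  have hoptimism : ∀ s ∈ Finset.Ico 1 T, -(η (s + 1) * ⟪g (s + 1), g (s + 1 - 1)⟫_ℝ) ≤
      (‖V (s + 1) - V s‖ ^ 2 + η (s + 1) ^ 2 * ‖g s‖ ^ 2) / 2 - η (s + 1) * ‖V s‖ ^ 2 -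
      η (s + 1) * (⟪g s, ξ (s + 1)⟫_ℝ + ⟪V s, ξ s⟫_ℝ) := fun s hs => by
    rw [Nat.add_sub_cancel, hg (s + 1) (by lia), hg s (Finset.mem_Ico.1 hs).1]
    exact neg_mul_inner_succ_le _ _ _ _ _
  have hround_sum := Finset.sum_le_sum hround
  have hoptimism_sum := Finset.sum_le_sum hoptimism
  have hDA := sum_inner_dualAveraging_add_le hlam hX p T
  have hhalf : ∀ t, lam t / 2 * ‖X t - X (t + 1)‖ ^ 2 = lam t * ‖X t - X (t + 1)‖ ^ 2 / 2 :=
    fun t => by ring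
  have hlast : 0 ≤ lam (T + 1) / 2 * ‖X (T + 1) - p‖ ^ 2 := by
    have := hlam_pos (T + 1); positivity
  simp only [Finset.sum_add_distrib] at hround_sum
  rw [sum_Icc_eq_sum_Ico_succ (f := fun t => -(η t * ⟪g t, g (t - 1)⟫_ℝ)) (by simp [hg_zero])]
    at hround_sum
  simp only [Finset.sum_add_distrib, Finset.sum_sub_distrib, ← Finset.sum_div, hhalf]
    at hround_sum hoptimism_sum hDA
  rw [optimisticNoise, optimisticGain]
  linarith

end OptimisticDualAveraging

/-! ### Trajectories of adaptive OptDA+ -/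

section Rates

variable {E : Type*} [SeminormedAddCommGroup E]

/-- `1 + ∑_{s=1}^t ‖g_s‖²`, the feedback received up to round `t` in the unit of the learning
rates. -/
noncomputable def energy (g : ℕ → E) (t : ℕ) : ℝ := cumul (fun s => ‖g s‖ ^ 2) t

/-- The inverse of the update rate at round `t`. -/
noncomputable def invRate (g X : ℕ → E) (t : ℕ) : ℝ :=
  √(cumul (fun s => ‖g s‖ ^ 2 + ‖X s - X (s + 1)‖ ^ 2) (t - 2))

/-- The squared path length `∑_{t=1}^T ‖X_t - X_{t+1}‖²` of the base iterates. -/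
noncomputable def pathVariation (X : ℕ → E) (T : ℕ) : ℝ :=
  ∑ t ∈ Finset.Icc 1 T, ‖X t - X (t + 1)‖ ^ 2

lemma one_le_energy (g : ℕ → E) (t : ℕ) : 1 ≤ energy g t :=
  one_le_cumul (fun _ => sq_nonneg _) t

lemma energy_pos (g : ℕ → E) (t : ℕ) : 0 < energy g t :=
  cumul_pos (fun _ => sq_nonneg _) t

lemma energy_mono (g : ℕ → E) : Monotone (energy g) :=
  cumul_mono fun _ => sq_nonneg _

lemma one_le_invRate (g X : ℕ → E) (t : ℕ) : 1 ≤ invRate g X t :=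
  Real.one_le_sqrt.2 (one_le_cumul (fun _ => by positivity) _)

lemma invRate_pos (g X : ℕ → E) (t : ℕ) : 0 < invRate g X t :=
  one_pos.trans_le (one_le_invRate g X t)

lemma invRate_mono (g X : ℕ → E) : Monotone (invRate g X) := fun _ _ h =>
  Real.sqrt_le_sqrt (cumul_mono (fun _ => by positivity) (by lia))

lemma sqrt_energy_le_invRate (g X : ℕ → E) (t : ℕ) : √(energy g (t - 2)) ≤ invRate g X t := by
  unfold energy invRate cumul
  gcongr
  exact le_add_of_nonneg_right (sq_nonneg _)

lemma sqrt_pathVariation_le_invRate (g X : ℕ → E) (t : ℕ) :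
    √(pathVariation X (t - 2)) ≤ invRate g X t := by
  unfold pathVariation invRate cumul
  refine Real.sqrt_le_sqrt (le_add_of_nonneg_of_le zero_le_one ?_)
  gcongr
  exact le_add_of_nonneg_left (sq_nonneg _)

lemma pathVariation_nonneg (X : ℕ → E) (T : ℕ) : 0 ≤ pathVariation X T :=
  Finset.sum_nonneg fun _ _ => sq_nonneg _

lemma pathVariation_le_sum_invRate_mul (g X : ℕ → E) (T : ℕ) :
    pathVariation X T ≤ ∑ t ∈ Finset.Icc 1 T, invRate g X t * ‖X t - X (t + 1)‖ ^ 2 :=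
  Finset.sum_le_sum fun t _ => le_mul_of_one_le_left (sq_nonneg _) (one_le_invRate g X t)

lemma invRate_succ_le (g X : ℕ → E) (T : ℕ) :
    invRate g X (T + 1) ≤ √(energy g T) + √(pathVariation X T) := by
  calc invRate g X (T + 1)
      ≤ √(cumul (fun s => ‖g s‖ ^ 2 + ‖X s - X (s + 1)‖ ^ 2) T) :=
        Real.sqrt_le_sqrt (cumul_mono (fun _ => by positivity) (by lia))
    _ = √(energy g T + pathVariation X T) := by
        rw [cumul, Finset.sum_add_distrib, energy, cumul, pathVariation, add_assoc]
    _ ≤ √(energy g T) + √(pathVariation X T) := by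
        refine Real.sqrt_le_iff.2 ⟨by positivity, ?_⟩
        rw [add_sq, Real.sq_sqrt (energy_pos g T).le, Real.sq_sqrt (pathVariation_nonneg X T)]
        linarith [show 0 ≤ 2 * √(energy g T) * √(pathVariation X T) by positivity]

lemma sum_sq_div_sqrt_energy_le {g : ℕ → E} {M : ℝ} (hM : ∀ t, 1 ≤ t → ‖g t‖ ≤ M) (T : ℕ) :
    ∑ t ∈ Finset.Icc 1 T, ‖g t‖ ^ 2 / √(energy g (t - 2)) ≤
      2 * √(1 + 2 * M ^ 2) * √(energy g T) :=
  sum_div_sqrt_cumul_le (a := fun s => ‖g s‖ ^ 2) (fun _ => sq_nonneg _)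
    (fun t ht => pow_le_pow_left₀ (norm_nonneg _) (hM t ht) 2) T

lemma sum_sq_div_invRate_le {g : ℕ → E} {M : ℝ} (hM : ∀ t, 1 ≤ t → ‖g t‖ ≤ M) (X : ℕ → E)
    (T : ℕ) :
    ∑ t ∈ Finset.Icc 1 T, ‖g t‖ ^ 2 / invRate g X t ≤ 2 * √(1 + 2 * M ^ 2) * √(energy g T) := by
  refine (Finset.sum_le_sum fun t _ => ?_).trans (sum_sq_div_sqrt_energy_le hM T)
  exact div_le_div_of_nonneg_left (sq_nonneg _) (Real.sqrt_pos.2 (energy_pos _ _))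
    (sqrt_energy_le_invRate g X t)

lemma mul_sqrt_le_div_add_sq (b : ℝ) {D : ℝ} (hD : 0 ≤ D) : b * √D ≤ D / 16 + 4 * b ^ 2 := by
  nlinarith [Real.sq_sqrt hD, sq_nonneg (√D / 4 - 2 * b)]

/-- The negative terms of dual averaging absorb the bounded part of the gradient variation, because
their weights grow with the path variation itself. -/
lemma mul_sum_min_one_add_le {K : ℝ} (hK : 0 ≤ K) (b : ℝ) (g X : ℕ → E) (T : ℕ) :
    K * ∑ t ∈ Finset.Icc 1 T, min 1 (‖X t - X (t + 1)‖ ^ 2) + b * √(pathVariation X T) +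
        pathVariation X T / 8 ≤
      (∑ t ∈ Finset.Icc 1 T, invRate g X t * ‖X t - X (t + 1)‖ ^ 2) / 4 +
        (K * ((K / (1 / 16)) ^ 2 + 2) + 4 * b ^ 2) := by
  have hmin := sum_mul_min_one_sub_le (b := fun t => ‖X t - X (t + 1)‖ ^ 2)
    (fun _ => sq_nonneg _) (show (0 : ℝ) < 1 / 16 by norm_num) hK
    (sqrt_pathVariation_le_invRate g X) T
  rw [Finset.sum_sub_distrib, ← Finset.mul_sum, ← Finset.mul_sum] at hmin
  have hsqrt := mul_sqrt_le_div_add_sq b (pathVariation_nonneg X T)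
  have hweights := pathVariation_le_sum_invRate_mul g X T
  linarith [pathVariation_nonneg X T]

end Rates

section Trajectory

variable {N : ℕ} {d : Fin N → ℕ} {ℓ : Fin N → Profile d → ℝ} {q M : ℝ} {X₁ : Profile d}
  {ξ X x g : ℕ → Profile d}

lemma extrapolationRate_eq (q : ℝ) (g : ℕ → Profile d) (t : ℕ) (j : Fin N) :
    extrapolationRate q g t j = energy (g · j) (t - 2) ^ (-(1 / 2 - q)) := rfl

lemma extrapolationRate_pos (q : ℝ) (g : ℕ → Profile d) (t : ℕ) (j : Fin N) :
    0 < extrapolationRate q g t j :=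
  Real.rpow_pos_of_pos (energy_pos (g · j) _) _

lemma extrapolationRate_sq_le (hq : q ≤ 1 / 4) (g : ℕ → Profile d) (t : ℕ) (j : Fin N) :
    extrapolationRate q g t j ^ 2 ≤ 1 / √(energy (g · j) (t - 2)) := by
  have hpos := energy_pos (g · j) (t - 2)
  rw [extrapolationRate_eq, ← Real.rpow_natCast, ← Real.rpow_mul hpos.le, Real.sqrt_eq_rpow,
    one_div (energy (g · j) (t - 2) ^ (1 / 2 : ℝ)), ← Real.rpow_neg hpos.le]
  exact Real.rpow_le_rpow_of_exponent_le (one_le_energy _ _) (by push_cast; linarith)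

lemma updateRate_eq (g X : ℕ → Profile d) (t : ℕ) (j : Fin N) :
    updateRate g X t j = (invRate (g · j) (X · j) t)⁻¹ := by
  rw [invRate, Real.sqrt_eq_rpow, ← Real.rpow_neg (cumul_pos (fun _ => by positivity) _).le]
  rfl

lemma sum_extrapolationRate_sq_mul_le (hM : ∀ t, 1 ≤ t → ∀ j, ‖g t j‖ ≤ M) (hq : q ≤ 1 / 4)
    (j : Fin N) (T : ℕ) :
    ∑ s ∈ Finset.Ico 1 T, extrapolationRate q g (s + 1) j ^ 2 * ‖g s j‖ ^ 2 ≤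
      2 * √(1 + 2 * M ^ 2) * √(energy (g · j) T) := by
  have hterm : ∀ s, extrapolationRate q g (s + 1) j ^ 2 * ‖g s j‖ ^ 2 ≤
      ‖g s j‖ ^ 2 / √(energy (g · j) (s - 2)) := fun s => by
    have hdelay : 1 / √(energy (g · j) (s + 1 - 2)) ≤ 1 / √(energy (g · j) (s - 2)) :=
      one_div_le_one_div_of_le (Real.sqrt_pos.2 (energy_pos _ _))
        (Real.sqrt_le_sqrt (energy_mono _ (by lia)))
    rw [← one_div_mul_eq_div]
    gcongr
    exact (extrapolationRate_sq_le hq g (s + 1) j).trans hdelay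
  refine le_trans ?_ (sum_sq_div_sqrt_energy_le (g := (g · j)) (fun t ht => hM t ht j) T)
  exact (Finset.sum_le_sum fun s _ => hterm s).trans
    (Finset.sum_le_sum_of_subset_of_nonneg Finset.Ico_subset_Icc_self fun _ _ _ => by positivity)

lemma IsAdaptiveOptDAPlus.invRate_smul (h : IsAdaptiveOptDAPlus ℓ q X₁ ξ X x g) (j : Fin N)
    (t : ℕ) :
    invRate (g · j) (X · j) (t + 1) • (X 1 j - X (t + 1) j) =
      ∑ s ∈ Finset.Icc 1 t, g s j := by
  rcases t with _ | t
  · simp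
  · rw [h.update (t + 1) (by lia) j, h.init, updateRate_eq, sub_sub_cancel, smul_smul,
      mul_inv_cancel₀ (invRate_pos _ _ _).ne', one_smul]

/-- The part with mean zero of the regret bound of player `j` for the comparator `p`. -/
noncomputable def noiseTerm (ℓ : Fin N → Profile d → ℝ) (q : ℝ) (ξ x g : ℕ → Profile d)
    (j : Fin N) (p : EuclideanSpace ℝ (Fin (d j))) (T : ℕ) : ℝ :=
  optimisticNoise (extrapolationRate q g · j) (fun t => grad ℓ j (x t)) (ξ · j) (x · j) (g · j) p T

/-- The negative term that extrapolation contributes to the regret bound of player `j`. -/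
noncomputable def extrapolationGain (ℓ : Fin N → Profile d → ℝ) (q : ℝ) (x g : ℕ → Profile d)
    (j : Fin N) (T : ℕ) : ℝ :=
  optimisticGain (extrapolationRate q g · j) (fun t => grad ℓ j (x t)) T

lemma extrapolationGain_nonneg (ℓ : Fin N → Profile d → ℝ) (q : ℝ) (x g : ℕ → Profile d)
    (j : Fin N) (T : ℕ) : 0 ≤ extrapolationGain ℓ q x g j T :=
  optimisticGain_nonneg (fun _ => (extrapolationRate_pos _ _ _ _).le) _ _

lemma IsAdaptiveOptDAPlus.linRegret_le (h : IsAdaptiveOptDAPlus ℓ q X₁ ξ X x g) (j : Fin N)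
    (p : EuclideanSpace ℝ (Fin (d j))) (T : ℕ) :
    linRegret ℓ j x T p ≤ invRate (g · j) (X · j) (T + 1) / 2 * ‖X₁ j - p‖ ^ 2 +
      (∑ t ∈ Finset.Icc 1 T, ‖g t j‖ ^ 2 / invRate (g · j) (X · j) t -
        (∑ t ∈ Finset.Icc 1 T, invRate (g · j) (X · j) t * ‖X t j - X (t + 1) j‖ ^ 2) / 4) +
      (∑ s ∈ Finset.Ico 1 T, ‖grad ℓ j (x (s + 1)) - grad ℓ j (x s)‖ ^ 2 +
        ∑ s ∈ Finset.Ico 1 T, extrapolationRate q g (s + 1) j ^ 2 * ‖g s j‖ ^ 2) / 2 -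
      extrapolationGain ℓ q x g j T + noiseTerm ℓ q ξ x g j p T := by
  rw [← h.init]
  exact sum_inner_optimisticDualAveraging_le (g := (g · j)) (X := (X · j)) (x := (x · j))
    (V := fun t => grad ℓ j (x t)) (ξ := (ξ · j)) (invRate_mono _ _) (invRate_pos _ _)
    (congrArg (· j) h.feedback_zero) (fun t ht => h.play t ht j) (fun t ht => h.feedback t ht j)
    (h.invRate_smul j) p T

lemma IsAdaptiveOptDAPlus.sq_norm_play_succ_sub_le (h : IsAdaptiveOptDAPlus ℓ q X₁ ξ X x g) {s : ℕ}
    (hs : 1 ≤ s) :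
    ‖x (s + 1) - x s‖ ^ 2 ≤ ∑ k, 3 * (‖X s k - X (s + 1) k‖ ^ 2 +
      (extrapolationRate q g (s + 1) k ^ 2 * ‖g s k‖ ^ 2 +
        extrapolationRate q g s k ^ 2 * ‖g (s - 1) k‖ ^ 2)) := by
  rw [PiLp.norm_sq_eq_of_L2]
  refine Finset.sum_le_sum fun k _ => ?_
  have hstep : (x (s + 1) - x s) k = (X (s + 1) k - X s k) +
      -(extrapolationRate q g (s + 1) k • g s k) + extrapolationRate q g s k • g (s - 1) k := by
    rw [PiLp.sub_apply, h.play (s + 1) (by lia) k, h.play s hs k, Nat.add_sub_cancel]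
    abel
  have hsmul : ∀ (c : ℝ) (v : EuclideanSpace ℝ (Fin (d k))), ‖c • v‖ ^ 2 = c ^ 2 * ‖v‖ ^ 2 :=
    fun c v => by rw [norm_smul, mul_pow, Real.norm_eq_abs, sq_abs]
  rw [hstep, ← add_assoc, ← hsmul, ← hsmul, ← norm_neg (_ • g s k), norm_sub_rev (X s k)]
  exact sq_norm_add_three_le _ _ _

/-- A player may be moved by a long step of another one, whose variation is then controlled only
through the bound `G` on the gradients: this is why the variation is truncated at `1`. -/
lemma IsAdaptiveOptDAPlus.sq_norm_grad_succ_sub_le (h : IsAdaptiveOptDAPlus ℓ q X₁ ξ X x g)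
    {L : ℝ≥0} {G : ℝ} (hL : ∀ i, LipschitzWith L (grad ℓ i)) (hG : ∀ i x, ‖grad ℓ i x‖ ≤ G)
    (j : Fin N) {s : ℕ} (hs : 1 ≤ s) :
    ‖grad ℓ j (x (s + 1)) - grad ℓ j (x s)‖ ^ 2 ≤
      ∑ k, ((4 * G ^ 2 + 3 * L ^ 2) * min 1 (‖X s k - X (s + 1) k‖ ^ 2) +
        3 * L ^ 2 * (extrapolationRate q g (s + 1) k ^ 2 * ‖g s k‖ ^ 2 +
          extrapolationRate q g s k ^ 2 * ‖g (s - 1) k‖ ^ 2)) := by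
  refine le_sum_mul_min_one_add (by positivity) (by positivity) (fun k => sq_nonneg _)
    (fun k => by positivity) ?_ ?_
  · have hdiff : ‖grad ℓ j (x (s + 1)) - grad ℓ j (x s)‖ ≤ 2 * G :=
      (norm_sub_le _ _).trans (by linarith [hG j (x (s + 1)), hG j (x s)])
    calc _ ≤ (2 * G) ^ 2 := by gcongr
      _ = 4 * G ^ 2 := by ring
  · calc ‖grad ℓ j (x (s + 1)) - grad ℓ j (x s)‖ ^ 2 ≤ ((L : ℝ) * ‖x (s + 1) - x s‖) ^ 2 := by
          gcongr
          exact (hL j).norm_sub_le _ _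
      _ ≤ (L : ℝ) ^ 2 * ∑ k, 3 * (‖X s k - X (s + 1) k‖ ^ 2 +
            (extrapolationRate q g (s + 1) k ^ 2 * ‖g s k‖ ^ 2 +
              extrapolationRate q g s k ^ 2 * ‖g (s - 1) k‖ ^ 2)) := by
          rw [mul_pow]
          gcongr
          exact h.sq_norm_play_succ_sub_le hs
      _ = _ := by rw [← Finset.mul_sum]; ring

/-- A trajectory of adaptive OptDA+ with `q ≤ 1 / 4` along which the feedback is bounded by `M`. -/
structure IsBoundedRun (ℓ : Fin N → Profile d → ℝ) (q : ℝ) (X₁ : Profile d) (M : ℝ)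
    (ξ X x g : ℕ → Profile d) : Prop extends IsAdaptiveOptDAPlus ℓ q X₁ ξ X x g where
  le_quarter : q ≤ 1 / 4
  norm_feedback_le : ∀ t, 1 ≤ t → ∀ j, ‖g t j‖ ≤ M

namespace IsBoundedRun

variable {L : ℝ≥0} {G : ℝ}

lemma sum_sq_norm_grad_succ_sub_le (h : IsBoundedRun ℓ q X₁ M ξ X x g)
    (hL : ∀ i, LipschitzWith L (grad ℓ i)) (hG : ∀ i x, ‖grad ℓ i x‖ ≤ G) (j : Fin N) (T : ℕ) :
    ∑ s ∈ Finset.Ico 1 T, ‖grad ℓ j (x (s + 1)) - grad ℓ j (x s)‖ ^ 2 ≤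
      ∑ k, ((4 * G ^ 2 + 3 * L ^ 2) *
          ∑ t ∈ Finset.Icc 1 T, min 1 (‖X t k - X (t + 1) k‖ ^ 2) +
        12 * L ^ 2 * √(1 + 2 * M ^ 2) * √(energy (g · k) T)) := by
  refine (Finset.sum_le_sum fun s hs =>
    h.sq_norm_grad_succ_sub_le hL hG j (Finset.mem_Ico.1 hs).1).trans ?_
  rw [Finset.sum_comm]
  refine Finset.sum_le_sum fun k _ => ?_
  set w : ℕ → ℝ := fun t => extrapolationRate q g t k ^ 2 * ‖g (t - 1) k‖ ^ 2 with hw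
  have hrate : ∑ s ∈ Finset.Ico 1 T, w (s + 1) ≤ 2 * √(1 + 2 * M ^ 2) * √(energy (g · k) T) :=
    sum_extrapolationRate_sq_mul_le h.norm_feedback_le h.le_quarter k T
  have hrate_delay : ∑ s ∈ Finset.Ico 1 T, w s ≤ ∑ s ∈ Finset.Ico 1 T, w (s + 1) := by
    rw [← sum_Icc_eq_sum_Ico_succ (by simp [hw, h.feedback_zero])]
    exact Finset.sum_le_sum_of_subset_of_nonneg Finset.Ico_subset_Icc_self
      fun _ _ _ => by positivity
  have hmin : ∑ s ∈ Finset.Ico 1 T, min 1 (‖X s k - X (s + 1) k‖ ^ 2) ≤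
      ∑ t ∈ Finset.Icc 1 T, min 1 (‖X t k - X (t + 1) k‖ ^ 2) :=
    Finset.sum_le_sum_of_subset_of_nonneg Finset.Ico_subset_Icc_self fun _ _ _ => by positivity
  rw [Finset.sum_add_distrib, ← Finset.mul_sum, ← Finset.mul_sum, Finset.sum_add_distrib]
  calc _ ≤ (4 * G ^ 2 + 3 * L ^ 2) * ∑ t ∈ Finset.Icc 1 T, min 1 (‖X t k - X (t + 1) k‖ ^ 2) +
        3 * L ^ 2 * (2 * √(1 + 2 * M ^ 2) * √(energy (g · k) T) +
          2 * √(1 + 2 * M ^ 2) * √(energy (g · k) T)) := by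
        gcongr
        · exact hrate
        · exact hrate_delay.trans hrate
    _ = _ := by ring

lemma linRegret_le_energy (h : IsBoundedRun ℓ q X₁ M ξ X x g)
    (hL : ∀ i, LipschitzWith L (grad ℓ i)) (hG : ∀ i x, ‖grad ℓ i x‖ ≤ G) (j : Fin N)
    {p : EuclideanSpace ℝ (Fin (d j))} {b : ℝ} (hb : ‖X₁ j - p‖ ^ 2 ≤ b) (T : ℕ) :
    linRegret ℓ j x T p ≤ noiseTerm ℓ q ξ x g j p T - extrapolationGain ℓ q x g j T +
      ∑ k, ((4 * G ^ 2 + 3 * L ^ 2) *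
          ∑ t ∈ Finset.Icc 1 T, min 1 (‖X t k - X (t + 1) k‖ ^ 2) +
        12 * L ^ 2 * √(1 + 2 * M ^ 2) * √(energy (g · k) T)) +
      (3 * √(1 + 2 * M ^ 2) + b) * √(energy (g · j) T) + b * √(pathVariation (X · j) T) -
      (∑ t ∈ Finset.Icc 1 T, invRate (g · j) (X · j) t * ‖X t j - X (t + 1) j‖ ^ 2) / 4 := by
  have hregret := h.linRegret_le j p T
  have hgrad := h.sum_sq_norm_grad_succ_sub_le hL hG j T
  have hrate := sum_extrapolationRate_sq_mul_le h.norm_feedback_le h.le_quarter j T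
  have hfeedback := sum_sq_div_invRate_le (fun t ht => h.norm_feedback_le t ht j) (X · j) T
  have hlast : invRate (g · j) (X · j) (T + 1) / 2 * ‖X₁ j - p‖ ^ 2 ≤
      (√(energy (g · j) T) + √(pathVariation (X · j) T)) * b :=
    mul_le_mul ((half_le_self (invRate_pos _ _ _).le).trans (invRate_succ_le _ _ T)) hb
      (sq_nonneg _) (by positivity)
  have hgrad_nonneg : 0 ≤ ∑ s ∈ Finset.Ico 1 T, ‖grad ℓ j (x (s + 1)) - grad ℓ j (x s)‖ ^ 2 :=
    Finset.sum_nonneg fun _ _ => sq_nonneg _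
  linarith

lemma sum_linRegret_le (h : IsBoundedRun ℓ q X₁ M ξ X x g)
    (hL : ∀ i, LipschitzWith L (grad ℓ i)) (hG : ∀ i x, ‖grad ℓ i x‖ ≤ G) (z : Profile d) {b : ℝ}
    (hb : ∀ j, ‖X₁ j - z j‖ ^ 2 ≤ b) (T : ℕ) :
    ∑ j, linRegret ℓ j x T (z j) ≤
      ∑ j, noiseTerm ℓ q ξ x g j (z j) T - ∑ j, extrapolationGain ℓ q x g j T -
      (∑ j, pathVariation (X · j) T) / 8 +
      (N * (12 * L ^ 2 * √(1 + 2 * M ^ 2)) + 3 * √(1 + 2 * M ^ 2) + b) *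
        ∑ j, √(energy (g · j) T) +
      N * (N * (4 * G ^ 2 + 3 * L ^ 2) *
        ((N * (4 * G ^ 2 + 3 * L ^ 2) / (1 / 16)) ^ 2 + 2) + 4 * b ^ 2) := by
  have hregret := Finset.sum_le_sum fun j (_ : j ∈ Finset.univ) =>
    h.linRegret_le_energy hL hG j (hb j) T
  have habsorb := Finset.sum_le_sum fun j (_ : j ∈ Finset.univ) =>
    mul_sum_min_one_add_le (show 0 ≤ N * (4 * G ^ 2 + 3 * (L : ℝ) ^ 2) by positivity) b (g · j)
      (X · j) T
  simp only [Finset.sum_add_distrib, Finset.sum_sub_distrib, Finset.sum_const, Finset.card_univ,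
    Fintype.card_fin, nsmul_eq_mul, ← Finset.mul_sum, ← Finset.sum_div] at hregret habsorb
  linarith

/-- By variational stability the regrets for the comparator `z` add up to a nonnegative number, so
that the negative terms of the regret bounds can be moved to the other side. -/
lemma exists_sum_extrapolationGain_add_le (hL : ∀ i, LipschitzWith L (grad ℓ i))
    (hG : ∀ i x, ‖grad ℓ i x‖ ≤ G) {z : Profile d}
    (hz : ∀ x, 0 ≤ ∑ i, ⟪grad ℓ i x, x i - z i⟫_ℝ) (X₁ : Profile d) (M : ℝ) :
    ∃ K, 0 ≤ K ∧ ∀ {q ξ X x g}, IsBoundedRun ℓ q X₁ M ξ X x g → ∀ T,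
      ∑ j, extrapolationGain ℓ q x g j T + (∑ j, pathVariation (X · j) T) / 8 ≤
        ∑ j, noiseTerm ℓ q ξ x g j (z j) T + K * (1 + ∑ j, √(energy (g · j) T)) := by
  have hb : ∀ j, ‖X₁ j - z j‖ ^ 2 ≤ ‖X₁ - z‖ ^ 2 := fun j => by
    gcongr
    exact PiLp.norm_apply_le (X₁ - z) j
  set b := ‖X₁ - z‖ ^ 2
  set c := N * (N * (4 * G ^ 2 + 3 * (L : ℝ) ^ 2) *
    ((N * (4 * G ^ 2 + 3 * (L : ℝ) ^ 2) / (1 / 16)) ^ 2 + 2) + 4 * b ^ 2)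
  set c' := N * (12 * (L : ℝ) ^ 2 * √(1 + 2 * M ^ 2)) + 3 * √(1 + 2 * M ^ 2) + b
  have hc : 0 ≤ c := by positivity
  have hc' : 0 ≤ c' := by positivity
  refine ⟨c + c', by positivity, fun {q ξ X x g} h T => ?_⟩
  have hstable : 0 ≤ ∑ j, linRegret ℓ j x T (z j) := by
    simp only [linRegret]
    rw [Finset.sum_comm]
    exact Finset.sum_nonneg fun t _ => hz (x t)
  have hregret : _ ≤ _ + c' * ∑ j, √(energy (g · j) T) + c := h.sum_linRegret_le hL hG z hb T
  have henergy : 0 ≤ ∑ j, √(energy (g · j) T) := Finset.sum_nonneg fun _ _ => Real.sqrt_nonneg _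
  linarith [mul_nonneg hc henergy]

lemma linRegret_le_pathVariation (h : IsBoundedRun ℓ q X₁ M ξ X x g)
    (hL : ∀ i, LipschitzWith L (grad ℓ i)) (hG : ∀ i x, ‖grad ℓ i x‖ ≤ G) (j : Fin N)
    {p : EuclideanSpace ℝ (Fin (d j))} {b : ℝ} (hb : ‖X₁ j - p‖ ^ 2 ≤ b) (T : ℕ) :
    linRegret ℓ j x T p ≤ noiseTerm ℓ q ξ x g j p T +
      (4 * G ^ 2 + 3 * L ^ 2 + b) * (∑ k, pathVariation (X · k) T) + b +
      (12 * L ^ 2 * √(1 + 2 * M ^ 2) + 3 * √(1 + 2 * M ^ 2) + b) *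
        ∑ k, √(energy (g · k) T) := by
  have hb0 : 0 ≤ b := (sq_nonneg _).trans hb
  have hregret := h.linRegret_le_energy hL hG j hb T
  have hmin : ∀ k, ∑ t ∈ Finset.Icc 1 T, min 1 (‖X t k - X (t + 1) k‖ ^ 2) ≤
      pathVariation (X · k) T := fun k => Finset.sum_le_sum fun _ _ => min_le_right _ _
  have hvariation : √(pathVariation (X · j) T) ≤ 1 + ∑ k, pathVariation (X · k) T := by
    have hj := Finset.single_le_sum (f := fun k => pathVariation (X · k) T)
      (fun k _ => pathVariation_nonneg _ T) (Finset.mem_univ j)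
    exact Real.sqrt_le_iff.2 ⟨by linarith [pathVariation_nonneg (X · j) T],
      by nlinarith [pathVariation_nonneg (X · j) T]⟩
  have henergy : √(energy (g · j) T) ≤ ∑ k, √(energy (g · k) T) :=
    Finset.single_le_sum (f := fun k => √(energy (g · k) T)) (fun _ _ => Real.sqrt_nonneg _)
      (Finset.mem_univ j)
  have hmin_sum : (4 * G ^ 2 + 3 * (L : ℝ) ^ 2) *
      ∑ k, ∑ t ∈ Finset.Icc 1 T, min 1 (‖X t k - X (t + 1) k‖ ^ 2) ≤
      (4 * G ^ 2 + 3 * (L : ℝ) ^ 2) * ∑ k, pathVariation (X · k) T := by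
    gcongr with k
    exact hmin k
  have hgain := extrapolationGain_nonneg ℓ q x g j T
  have hweights := (pathVariation_nonneg _ _).trans
    (pathVariation_le_sum_invRate_mul (g · j) (X · j) T)
  simp only [Finset.sum_add_distrib, ← Finset.mul_sum] at hregret
  linarith [mul_le_mul_of_nonneg_left hvariation hb0, mul_le_mul_of_nonneg_left henergy
    (show 0 ≤ 3 * √(1 + 2 * M ^ 2) + b by positivity)]

lemma exists_linRegret_le (hL : ∀ i, LipschitzWith L (grad ℓ i))
    (hG : ∀ i x, ‖grad ℓ i x‖ ≤ G) {z : Profile d}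
    (hz : ∀ x, 0 ≤ ∑ i, ⟪grad ℓ i x, x i - z i⟫_ℝ) (X₁ : Profile d) (M ρ : ℝ) :
    ∃ K c, 0 ≤ K ∧ ∀ {q ξ X x g}, IsBoundedRun ℓ q X₁ M ξ X x g → ∀ T j p, ‖p‖ ≤ ρ →
      linRegret ℓ j x T p ≤ noiseTerm ℓ q ξ x g j p T +
        c * ∑ k, noiseTerm ℓ q ξ x g k (z k) T + K * (1 + ∑ k, √(energy (g · k) T)) := by
  obtain ⟨K, hK, hgain⟩ := exists_sum_extrapolationGain_add_le hL hG hz X₁ M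
  set b := (‖X₁‖ + ρ) ^ 2
  set A := 4 * G ^ 2 + 3 * (L : ℝ) ^ 2 + b
  set B := 12 * (L : ℝ) ^ 2 * √(1 + 2 * M ^ 2) + 3 * √(1 + 2 * M ^ 2) + b
  have hA : 0 ≤ A := by positivity
  have hB : 0 ≤ B := by positivity
  refine ⟨A * (8 * K) + b + B, A * 8, by positivity, fun {q ξ X x g} h T j p hp => ?_⟩
  have hb : ‖X₁ j - p‖ ^ 2 ≤ b := pow_le_pow_left₀ (norm_nonneg _)
    ((norm_sub_le _ _).trans (add_le_add (PiLp.norm_apply_le X₁ j) hp)) 2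
  have hregret := h.linRegret_le_pathVariation hL hG j hb T
  have hgain_nonneg : 0 ≤ ∑ k, extrapolationGain ℓ q x g k T :=
    Finset.sum_nonneg fun _ _ => extrapolationGain_nonneg _ _ _ _ _ _
  have hvariation : ∑ k, pathVariation (X · k) T ≤ 8 * (∑ k, noiseTerm ℓ q ξ x g k (z k) T +
      K * (1 + ∑ k, √(energy (g · k) T))) := by linarith [hgain h T]
  have henergy : 0 ≤ ∑ k, √(energy (g · k) T) := Finset.sum_nonneg fun _ _ => Real.sqrt_nonneg _
  linarith [mul_le_mul_of_nonneg_left hvariation hA, mul_nonneg (sq_nonneg (‖X₁‖ + ρ)) henergy]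

end IsBoundedRun

end Trajectory

/-! ### Smooth convex games -/

section Gradient

variable {E : Type*} [NormedAddCommGroup E] [InnerProductSpace ℝ E] [CompleteSpace E]
  {f : E → ℝ} {f' y p : E}

lemma hasDerivAt_comp_lineMap {s : ℝ} (h : HasGradientAt f f' (AffineMap.lineMap y p s)) :
    HasDerivAt (fun s : ℝ => f (AffineMap.lineMap y p s)) ⟪f', p - y⟫_ℝ s :=
  h.hasFDerivAt.comp_hasDerivAt s AffineMap.hasDerivAt_lineMap

lemma inner_gradient_le_sub (hf : ConvexOn ℝ Set.univ f) (h : HasGradientAt f f' y) (p : E) :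
    ⟪f', p - y⟫_ℝ ≤ f p - f y := by
  have hderiv : HasDerivAt (fun s : ℝ => f (AffineMap.lineMap y p s)) ⟪f', p - y⟫_ℝ 0 :=
    hasDerivAt_comp_lineMap (by rwa [AffineMap.lineMap_apply_zero])
  have hconvex : ConvexOn ℝ Set.univ fun s : ℝ => f (AffineMap.lineMap y p s) :=
    hf.comp_affineMap (AffineMap.lineMap y p)
  simpa [slope_def_field] using
    hconvex.le_slope_of_hasDerivAt (Set.mem_univ 0) (Set.mem_univ 1) one_pos hderiv

end Gradient

section Game

variable {N : ℕ} {d : Fin N → ℕ} {ℓ : Fin N → Profile d → ℝ} {L : ℝ≥0} {G : ℝ}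

lemma deviate_self (x : Profile d) (i : Fin N) : deviate x i (x i) = x := by
  simp [deviate]

lemma deviate_apply (x : Profile d) (i : Fin N) (y : EuclideanSpace ℝ (Fin (d i))) :
    deviate x i y i = y := by
  simp [deviate]

lemma deviate_deviate (x : Profile d) (i : Fin N) (y y' : EuclideanSpace ℝ (Fin (d i))) :
    deviate (deviate x i y) i y' = deviate x i y' := by
  simp [deviate]

lemma continuous_deviate {α : Type*} [TopologicalSpace α] {i : Fin N} {f : α → Profile d}
    {h : α → EuclideanSpace ℝ (Fin (d i))} (hf : Continuous f) (hh : Continuous h) :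
    Continuous fun a => deviate (f a) i (h a) :=
  (PiLp.continuous_toLp 2 _).comp (((PiLp.continuous_ofLp 2 _).comp hf).update i hh)

namespace IsSmoothConvexGame

lemma continuous_grad (hℓ : IsSmoothConvexGame ℓ L) (i : Fin N) : Continuous (grad ℓ i) :=
  (hℓ.lipschitz i).continuous

lemma hasGradientAt (hℓ : IsSmoothConvexGame ℓ L) (i : Fin N) (x : Profile d)
    (y : EuclideanSpace ℝ (Fin (d i))) :
    HasGradientAt (fun y => ℓ i (deviate x i y)) (grad ℓ i (deviate x i y)) y := by
  have hgrad : grad ℓ i (deviate x i y) = gradient (fun y => ℓ i (deviate x i y)) y := by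
    simp only [grad, deviate_deviate, deviate_apply]
  rw [hgrad]
  exact (hℓ.differentiable i x y).hasGradientAt

lemma sub_deviate_le_inner (hℓ : IsSmoothConvexGame ℓ L) (i : Fin N) (x : Profile d)
    (p : EuclideanSpace ℝ (Fin (d i))) : ℓ i x - ℓ i (deviate x i p) ≤ ⟪grad ℓ i x, x i - p⟫_ℝ := by
  have hinner := inner_gradient_le_sub (hℓ.convex i x) (hℓ.hasGradientAt i x (x i)) p
  rw [deviate_self, ← neg_sub, inner_neg_right] at hinner
  linarith

lemma abs_sub_deviate_le (hℓ : IsSmoothConvexGame ℓ L) (hG : ∀ i x, ‖grad ℓ i x‖ ≤ G) (i : Fin N)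
    (x : Profile d) (p : EuclideanSpace ℝ (Fin (d i))) :
    |ℓ i x - ℓ i (deviate x i p)| ≤ G * ‖x i - p‖ := by
  have hinner : ∀ x', |⟪grad ℓ i x', x i - p⟫_ℝ| ≤ G * ‖x i - p‖ := fun x' =>
    (abs_real_inner_le_norm _ _).trans (by gcongr; exact hG i x')
  have hlower := inner_gradient_le_sub (hℓ.convex i x) (hℓ.hasGradientAt i x p) (x i)
  rw [deviate_self] at hlower
  exact abs_le.2 ⟨(neg_le_of_abs_le (hinner _)).trans hlower,
    (hℓ.sub_deviate_le_inner i x p).trans (le_of_abs_le (hinner _))⟩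

/-- The loss itself need not be continuous in the joint action: the difference is the integral of
the gradient over the segment from `p` to the action of player `i`. -/
lemma continuous_sub_deviate (hℓ : IsSmoothConvexGame ℓ L) (i : Fin N)
    (p : EuclideanSpace ℝ (Fin (d i))) : Continuous fun x => ℓ i x - ℓ i (deviate x i p) := by
  have hc : Continuous (fun a : Profile d × ℝ =>
      ⟪grad ℓ i (deviate a.1 i (AffineMap.lineMap p (a.1 i) a.2)), a.1 i - p⟫_ℝ) := by
    have hproj : Continuous fun a : Profile d × ℝ => a.1 i := by fun_prop
    refine ((hℓ.continuous_grad i).comp (continuous_deviate continuous_fst ?_)).inner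
      (hproj.sub continuous_const)
    simp only [AffineMap.lineMap_apply_module']
    fun_prop
  have hintegral : (fun x => ℓ i x - ℓ i (deviate x i p)) = fun x => ∫ s in (0 : ℝ)..1,
      ⟪grad ℓ i (deviate x i (AffineMap.lineMap p (x i) s)), x i - p⟫_ℝ := by
    funext x
    rw [intervalIntegral.integral_eq_sub_of_hasDerivAt
      (fun s _ => hasDerivAt_comp_lineMap (hℓ.hasGradientAt i x (AffineMap.lineMap p (x i) s)))
      ((hc.comp (Continuous.prodMk_right x)).intervalIntegrable 0 1)]
    simp only [AffineMap.lineMap_apply_one, AffineMap.lineMap_apply_zero, deviate_self]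
  rw [hintegral]
  exact intervalIntegral.continuous_parametric_intervalIntegral_of_continuous' hc 0 1

variable (i : Fin N) (x : ℕ → Profile d) (T : ℕ)

lemma regret_le_linRegret (hℓ : IsSmoothConvexGame ℓ L) (p : EuclideanSpace ℝ (Fin (d i))) :
    regret ℓ i x T p ≤ linRegret ℓ i x T p :=
  Finset.sum_le_sum fun t _ => hℓ.sub_deviate_le_inner i (x t) p

lemma continuous_regret (hℓ : IsSmoothConvexGame ℓ L) : Continuous fun p => regret ℓ i x T p :=
  continuous_finsetSum _ fun t _ => continuous_const.sub (hℓ.differentiable i (x t)).continuous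

lemma abs_regret_le (hℓ : IsSmoothConvexGame ℓ L) (hG : ∀ i x, ‖grad ℓ i x‖ ≤ G)
    (p : EuclideanSpace ℝ (Fin (d i))) :
    |regret ℓ i x T p| ≤ ∑ t ∈ Finset.Icc 1 T, G * ‖x t i - p‖ :=
  (Finset.abs_sum_le_sum_abs _ _).trans
    (Finset.sum_le_sum fun t _ => hℓ.abs_sub_deviate_le hG i (x t) p)

end IsSmoothConvexGame

variable (i : Fin N) (x : ℕ → Profile d) (T : ℕ)

lemma continuous_linRegret : Continuous fun p => linRegret ℓ i x T p := by
  unfold linRegret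
  fun_prop

lemma abs_linRegret_le (hG : ∀ i x, ‖grad ℓ i x‖ ≤ G) (p : EuclideanSpace ℝ (Fin (d i))) :
    |linRegret ℓ i x T p| ≤ ∑ t ∈ Finset.Icc 1 T, G * ‖x t i - p‖ :=
  (Finset.abs_sum_le_sum_abs _ _).trans (Finset.sum_le_sum fun t _ =>
    (abs_real_inner_le_norm _ _).trans (mul_le_mul_of_nonneg_right (hG i (x t)) (norm_nonneg _)))

end Game

/-! ### Suprema and centered random variables -/

section Supremum

variable {Ω E : Type*} [MeasurableSpace Ω] {μ : Measure Ω} {P : Set E} {R : E → Ω → ℝ}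

lemma ExpectationSupLE.supExpectationLE {c : ℝ} (h : ExpectationSupLE μ P R c)
    (hR : ∀ p ∈ P, Integrable (R p) μ) : SupExpectationLE μ P R c := fun p hp =>
  ⟨hR p hp, (integral_mono (hR p hp) h.2.1 fun ω => le_ciSup (h.1 ω) ⟨p, hp⟩).trans h.2.2⟩

lemma abs_iSup_le_of_nonneg {ι : Sort*} {f : ι → ℝ} {b : ℝ} (hb : 0 ≤ b) (h : ∀ i, |f i| ≤ b) :
    |⨆ i, f i| ≤ b := by
  rcases isEmpty_or_nonempty ι with _ | ⟨⟨i⟩⟩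
  · rwa [Real.iSup_of_isEmpty, abs_zero]
  · have hbdd : BddAbove (Set.range f) :=
      ⟨b, Set.forall_mem_range.2 fun i => (abs_le.1 (h i)).2⟩
    exact abs_le.2 ⟨(abs_le.1 (h i)).1.trans (le_ciSup hbdd i),
      Real.iSup_le (fun i => (abs_le.1 (h i)).2) hb⟩

variable [TopologicalSpace E] [SecondCountableTopology E]

lemma measurable_iSup_of_continuous (P : Set E) (hc : ∀ ω, Continuous fun p => R p ω)
    (hm : ∀ p, Measurable (R p)) : Measurable fun ω => ⨆ p : P, R p ω := by
  obtain ⟨S, hS_countable, hS_dense⟩ := TopologicalSpace.exists_countable_dense P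
  have : Countable S := hS_countable
  have hsup : (fun ω => ⨆ p : P, R p ω) = fun ω => ⨆ s : S, R s ω := funext fun ω =>
    (hS_dense.ciSup' (f := fun p : P => R p ω) ((hc ω).comp continuous_subtype_val)).symm
  rw [hsup]
  exact Measurable.iSup fun s => hm s

lemma expectationSupLE_of_le {b Z : Ω → ℝ} {c : ℝ} (hc : ∀ ω, Continuous fun p => R p ω)
    (hm : ∀ p, Measurable (R p)) (hb : Integrable b μ) (hb0 : ∀ ω, 0 ≤ b ω)
    (hRb : ∀ ω, ∀ p ∈ P, |R p ω| ≤ b ω) (hZ : Integrable Z μ)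
    (hRZ : ∀ᵐ ω ∂μ, ∀ p ∈ P, R p ω ≤ Z ω) (hZc : ∫ ω, Z ω ∂μ ≤ c) (hc0 : 0 ≤ c) :
    ExpectationSupLE μ P R c := by
  have hint : Integrable (fun ω => ⨆ p : P, R p ω) μ :=
    hb.mono' (measurable_iSup_of_continuous P hc hm).aestronglyMeasurable
      (.of_forall fun ω => abs_iSup_le_of_nonneg (hb0 ω) fun p => hRb ω p p.2)
  refine ⟨fun ω => ⟨b ω, ?_⟩, hint, ?_⟩
  · exact Set.forall_mem_range.2 fun p => (abs_le.1 (hRb ω p p.2)).2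
  · rcases isEmpty_or_nonempty P with _ | _
    · simpa only [Real.iSup_of_isEmpty, integral_zero] using hc0
    · refine (integral_mono_ae hint hZ ?_).trans hZc
      filter_upwards [hRZ] with ω hω using ciSup_le fun p => hω p p.2

end Supremum

section Centered

variable {Ω : Type*} [MeasurableSpace Ω] {μ : Measure Ω} {f h : Ω → ℝ}

/-- Integrable random variables of mean zero; the noise enters the analysis through these only. -/
def IsCentered (μ : Measure Ω) (f : Ω → ℝ) : Prop :=
  Integrable f μ ∧ ∫ ω, f ω ∂μ = 0

lemma IsCentered.add (hf : IsCentered μ f) (hh : IsCentered μ h) :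
    IsCentered μ fun ω => f ω + h ω :=
  ⟨hf.1.add hh.1, by rw [integral_add hf.1 hh.1, hf.2, hh.2, add_zero]⟩

lemma IsCentered.sub (hf : IsCentered μ f) (hh : IsCentered μ h) :
    IsCentered μ fun ω => f ω - h ω :=
  ⟨hf.1.sub hh.1, by rw [integral_sub hf.1 hh.1, hf.2, hh.2, sub_zero]⟩

lemma IsCentered.const_mul (hf : IsCentered μ f) (c : ℝ) : IsCentered μ fun ω => c * f ω :=
  ⟨hf.1.const_mul c, by rw [integral_const_mul, hf.2, mul_zero]⟩

lemma IsCentered.sum {ι : Type*} {s : Finset ι} {f : ι → Ω → ℝ}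
    (hf : ∀ k ∈ s, IsCentered μ (f k)) : IsCentered μ fun ω => ∑ k ∈ s, f k ω :=
  ⟨integrable_finsetSum s fun k hk => (hf k hk).1, by
    rw [integral_finsetSum s fun k hk => (hf k hk).1]
    exact Finset.sum_eq_zero fun k hk => (hf k hk).2⟩

end Centered

section Bounded

variable {Ω E : Type*} [MeasurableSpace Ω] {μ : Measure Ω} [NormedAddCommGroup E]

lemma memLp_inner [InnerProductSpace ℝ E] {p q r : ENNReal} [hpqr : ENNReal.HolderTriple p q r]
    {f h : Ω → E} (hf : MemLp f p μ) (hh : MemLp h q μ) : MemLp (fun ω => ⟪f ω, h ω⟫_ℝ) r μ :=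
  hf.of_bilin (fun v w => ⟪v, w⟫_ℝ) 1 hh (hf.1.inner hh.1) (.of_forall fun ω => by
    simpa only [one_mul] using nnnorm_inner_le_nnnorm (f ω) (h ω))

lemma memLp_top_norm_sq {f : Ω → E} (hf : MemLp f ⊤ μ) : MemLp (fun ω => ‖f ω‖ ^ 2) ⊤ μ := by
  simpa only [sq] using hf.norm.mul' hf.norm

end Bounded

section Conditioning

variable {Ω E : Type*} {m m₀ : MeasurableSpace Ω} {μ : Measure Ω} [IsFiniteMeasure μ]
  [NormedAddCommGroup E] [InnerProductSpace ℝ E] [CompleteSpace E]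

lemma isCentered_inner_of_condExp_eq_zero {h ξ : Ω → E} (hm : m ≤ m₀)
    (hh : StronglyMeasurable[m] h) (hh_mem : MemLp h ⊤ μ) (hξ_int : Integrable ξ μ)
    (hξ : μ[ξ | m] =ᵐ[μ] 0) : IsCentered μ fun ω => ⟪h ω, ξ ω⟫_ℝ := by
  have hint : Integrable (fun ω => ⟪h ω, ξ ω⟫_ℝ) μ :=
    memLp_one_iff_integrable.1 (memLp_inner hh_mem (memLp_one_iff_integrable.2 hξ_int))
  have hpull := condExp_bilin_of_stronglyMeasurable_left (innerSL ℝ) hh hint hξ_int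
  have hzero : μ[fun ω => ⟪h ω, ξ ω⟫_ℝ | m] =ᵐ[μ] 0 := by
    filter_upwards [hpull, hξ] with ω hω hξω
    exact hω.trans (by rw [hξω]; exact inner_zero_right _)
  refine ⟨hint, ?_⟩
  rw [← integral_condExp hm, integral_congr_ae hzero]
  exact integral_zero _ _

lemma integral_mul_le_of_condExp_le {w f F : Ω → ℝ} (hm : m ≤ m₀) (hw : StronglyMeasurable[m] w)
    (hw0 : ∀ ω, 0 ≤ w ω) (hw_mem : MemLp w ⊤ μ) (hf : Integrable f μ)
    (hF : Integrable F μ) (hle : μ[f | m] ≤ᵐ[μ] F) :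
    ∫ ω, w ω * f ω ∂μ ≤ ∫ ω, w ω * F ω ∂μ := by
  have hpull : μ[w * f | m] =ᵐ[μ] w * μ[f | m] :=
    condExp_mul_of_stronglyMeasurable_left hw (hf.mul_of_top_right hw_mem) hf
  calc ∫ ω, w ω * f ω ∂μ = ∫ ω, μ[w * f | m] ω ∂μ := (integral_condExp hm).symm
    _ ≤ ∫ ω, w ω * F ω ∂μ := by
        refine integral_mono_ae integrable_condExp (hF.mul_of_top_right hw_mem) ?_
        filter_upwards [hpull, hle] with ω hω hleω
        rw [hω]
        exact mul_le_mul_of_nonneg_left hleω (hw0 ω)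

end Conditioning

/-! ### Measurability of the play -/

section Measurability

variable {N : ℕ} {d : Fin N → ℕ} {Ω : Type*} {m : MeasurableSpace Ω}

lemma measurable_profile {f : Ω → Profile d} (h : ∀ i, Measurable fun ω => f ω i) :
    Measurable f :=
  (WithLp.measurable_toLp 2 _).comp (measurable_pi_iff.2 h)

lemma measurable_profile_apply {f : Ω → Profile d} (h : Measurable f) (i : Fin N) :
    Measurable fun ω => f ω i :=
  (show Continuous fun y : Profile d => y i by fun_prop).measurable.comp h

lemma measurable_energy {E : Type*} [NormedAddCommGroup E] [MeasurableSpace E]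
    [OpensMeasurableSpace E] {g : ℕ → Ω → E} {t : ℕ}
    (hg : ∀ s, 1 ≤ s → s ≤ t → Measurable (g s)) :
    Measurable fun ω => energy (g · ω) t :=
  measurable_const.add <| Finset.measurable_fun_sum _ fun s hs =>
    (hg s (Finset.mem_Icc.1 hs).1 (Finset.mem_Icc.1 hs).2).norm.pow_const 2

variable {g X : ℕ → Ω → Profile d} {j : Fin N} {t : ℕ}

lemma measurable_extrapolationRate (q : ℝ)
    (hg : ∀ s, 1 ≤ s → s + 1 < t → Measurable fun ω => g s ω j) :
    Measurable fun ω => extrapolationRate q (g · ω) t j :=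
  (measurable_energy (g := fun s ω => g s ω j) fun s hs hst =>
    hg s hs (by lia)).pow_const (-(1 / 2 - q))

lemma measurable_updateRate (hg : ∀ s, 1 ≤ s → s + 1 < t → Measurable fun ω => g s ω j)
    (hX : ∀ s, 1 ≤ s → s < t → Measurable fun ω => X s ω j) :
    Measurable fun ω => updateRate (g · ω) (X · ω) t j := by
  refine (measurable_const.add (Finset.measurable_fun_sum _ fun s hs => ?_)).pow_const _
  obtain ⟨hs1, hst⟩ := Finset.mem_Icc.1 hs
  have hdiff := (hX s hs1 (by lia)).sub (hX (s + 1) (by lia) (by lia))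
  exact ((hg s hs1 (by lia)).norm.pow_const 2).add (hdiff.norm.pow_const 2)

lemma measurable_sum_feedback {n : ℕ} (hn : n < t)
    (hg : ∀ s, 1 ≤ s → s < t → Measurable fun ω => g s ω j) :
    Measurable fun ω => ∑ s ∈ Finset.Icc 1 n, g s ω j :=
  Finset.measurable_fun_sum _ fun s hs =>
    hg s (Finset.mem_Icc.1 hs).1 ((Finset.mem_Icc.1 hs).2.trans_lt hn)

variable {ℓ : Fin N → Profile d → ℝ} {q : ℝ} {X₁ : Profile d} {ξ x : ℕ → Ω → Profile d}

lemma measurable_iterate (h : ∀ ω, IsAdaptiveOptDAPlus ℓ q X₁ (ξ · ω) (X · ω) (x · ω) (g · ω))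
    (ht : 1 ≤ t) (hg : ∀ s, 1 ≤ s → s < t → Measurable fun ω => g s ω j) :
    Measurable fun ω => X t ω j := by
  induction t using Nat.strong_induction_on with
  | _ t ih =>
  rcases ht.eq_or_lt with rfl | ht1
  · simpa only [(h _).init] using measurable_const
  · obtain ⟨n, hn, rfl⟩ : ∃ n, 1 ≤ n ∧ n + 1 = t := ⟨t - 1, by lia, by lia⟩
    have hX : ∀ s, 1 ≤ s → s < n + 1 → Measurable fun ω => X s ω j := fun s hs hst =>
      ih s hst hs fun r hr hrs => hg r hr (hrs.trans hst)
    simp only [(h _).update n hn j]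
    exact measurable_const.sub
      ((measurable_updateRate (fun s hs hst => hg s hs (by lia)) hX).smul
        (measurable_sum_feedback n.lt_succ_self hg))

lemma measurable_action (h : ∀ ω, IsAdaptiveOptDAPlus ℓ q X₁ (ξ · ω) (X · ω) (x · ω) (g · ω))
    (ht : 1 ≤ t) (hg : ∀ s, 1 ≤ s → s < t → Measurable fun ω => g s ω j) :
    Measurable fun ω => x t ω j := by
  have hlast : Measurable fun ω => g (t - 1) ω j := by
    rcases ht.eq_or_lt with rfl | ht1
    · have hzero : (fun ω => g (1 - 1) ω j) = 0 := funext fun ω =>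
        congrArg (· j) (h ω).feedback_zero
      exact hzero ▸ measurable_zero
    · exact hg (t - 1) (by lia) (by lia)
  simp only [(h _).play t ht j]
  exact (measurable_iterate h ht hg).sub ((measurable_extrapolationRate q
    fun s hs hst => hg s hs (by lia)).smul hlast)

lemma updateRate_pos (g X : ℕ → Profile d) (t : ℕ) (j : Fin N) : 0 < updateRate g X t j := by
  rw [updateRate_eq]
  exact inv_pos.2 (invRate_pos _ _ t)

/-- The feedback of a round enters the next action both through the update and through the
extrapolation, with weights of the same sign; hence it can be read off from that action. -/
lemma IsAdaptiveOptDAPlus.feedback_succ_eq {ξ X x g : ℕ → Profile d}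
    (h : IsAdaptiveOptDAPlus ℓ q X₁ ξ X x g) (n : ℕ) (j : Fin N) :
    g (n + 1) j = (updateRate g X (n + 2) j + extrapolationRate q g (n + 2) j)⁻¹ •
      (X₁ j - updateRate g X (n + 2) j • ∑ s ∈ Finset.Icc 1 n, g s j - x (n + 2) j) := by
  have hrate : 0 < updateRate g X (n + 2) j + extrapolationRate q g (n + 2) j :=
    add_pos (updateRate_pos g X _ j) (extrapolationRate_pos q g _ j)
  rw [eq_inv_smul_iff₀ hrate.ne', h.play (n + 2) (by lia) j, h.update (n + 1) (by lia) j,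
    Finset.sum_Icc_succ_top (by lia)]
  simp only [Nat.add_succ_sub_one]
  module

lemma measurable_feedback_of_lt
    (h : ∀ ω, IsAdaptiveOptDAPlus ℓ q X₁ (ξ · ω) (X · ω) (x · ω) (g · ω))
    (hx : ∀ s, 1 ≤ s → s ≤ t → Measurable fun ω => x s ω j) {s : ℕ} (hs : 1 ≤ s) (hst : s < t) :
    Measurable fun ω => g s ω j := by
  induction s using Nat.strong_induction_on with
  | _ s ih =>
  obtain ⟨n, rfl⟩ : ∃ n, s = n + 1 := ⟨s - 1, by lia⟩
  have hg : ∀ r, 1 ≤ r → r < n + 1 → Measurable fun ω => g r ω j :=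
    fun r hr hrn => ih r hrn hr (hrn.trans hst)
  have hX : ∀ r, 1 ≤ r → r < n + 2 → Measurable fun ω => X r ω j :=
    fun r hr hrn => measurable_iterate h hr fun r' hr' hrr' => hg r' hr' (by lia)
  have hupdate : Measurable fun ω => updateRate (g · ω) (X · ω) (n + 2) j :=
    measurable_updateRate (fun r hr hrn => hg r hr (by lia)) hX
  have hextra : Measurable fun ω => extrapolationRate q (g · ω) (n + 2) j :=
    measurable_extrapolationRate q fun r hr hrn => hg r hr (by lia)
  simp only [(h _).feedback_succ_eq n j]
  exact (hupdate.add hextra).inv.smul ((measurable_const.sub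
    (hupdate.smul (measurable_sum_feedback n.lt_succ_self hg))).sub (hx (n + 2) (by lia) hst))

lemma measurable_playHistory (x : ℕ → Ω → Profile d) {s t : ℕ} (hs : 1 ≤ s) (hst : s ≤ t) :
    Measurable[playHistory x t] (x s) :=
  (comap_measurable (x s)).mono
    (le_biSup (fun s => MeasurableSpace.comap (x s) inferInstance) ⟨hs, hst⟩) le_rfl

end Measurability

section NoisyPlay

variable {N : ℕ} {d : Fin N → ℕ} {Ω : Type*} [m₀ : MeasurableSpace Ω]

/-- All players run adaptive OptDA+ from `X₁` against unbiased noise bounded by `σ`, in a smooth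
convex game whose individual gradients are bounded by `G`. -/
structure IsNoisyPlay (μ : Measure Ω) (ℓ : Fin N → Profile d → ℝ) (L : ℝ≥0) (G σ q : ℝ)
    (X₁ : Profile d) (ξ X x g : ℕ → Ω → Profile d) : Prop where
  game : IsSmoothConvexGame ℓ L
  norm_grad_le : ∀ i x, ‖grad ℓ i x‖ ≤ G
  le_quarter : q ≤ 1 / 4
  path : ∀ ω, IsAdaptiveOptDAPlus ℓ q X₁ (ξ · ω) (X · ω) (x · ω) (g · ω)
  noise : IsUnbiasedBoundedNoise μ ξ x σ

variable {μ : Measure Ω} {ℓ : Fin N → Profile d → ℝ} {L : ℝ≥0} {G σ q : ℝ}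
  {X₁ : Profile d} {ξ X x g : ℕ → Ω → Profile d}

namespace IsNoisyPlay

lemma measurable_feedback (H : IsNoisyPlay μ ℓ L G σ q X₁ ξ X x g) {t : ℕ} (ht : 1 ≤ t)
    (j : Fin N) : Measurable fun ω => g t ω j := by
  induction t using Nat.strong_induction_on generalizing j with
  | _ t ih =>
  have haction : Measurable (x t) :=
    measurable_profile fun i => measurable_action H.path ht fun s hs hst => ih s hst hs i
  simp only [(H.path _).feedback t ht j]
  exact ((H.game.continuous_grad j).measurable.comp haction).add
    (measurable_profile_apply (H.noise.measurable t ht) j)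

lemma measurable_action (H : IsNoisyPlay μ ℓ L G σ q X₁ ξ X x g) {t : ℕ} (ht : 1 ≤ t) :
    Measurable (x t) :=
  measurable_profile fun _ =>
    NoisyGame.measurable_action H.path ht fun _ hs _ => H.measurable_feedback hs _

lemma playHistory_le (H : IsNoisyPlay μ ℓ L G σ q X₁ ξ X x g) (t : ℕ) : playHistory x t ≤ m₀ :=
  iSup₂_le fun _ hs => (H.measurable_action hs.1).comap_le

lemma measurable_playHistory_feedback (H : IsNoisyPlay μ ℓ L G σ q X₁ ξ X x g) {s t : ℕ}
    (hs : 1 ≤ s) (hst : s < t) (j : Fin N) : Measurable[playHistory x t] fun ω => g s ω j :=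
  measurable_feedback_of_lt H.path
    (fun _ hr hrt => measurable_profile_apply (measurable_playHistory x hr hrt) j) hs hst

lemma measurable_playHistory_grad (H : IsNoisyPlay μ ℓ L G σ q X₁ ξ X x g) {s t : ℕ}
    (hs : 1 ≤ s) (hst : s ≤ t) (j : Fin N) :
    Measurable[playHistory x t] fun ω => grad ℓ j (x s ω) :=
  (H.game.continuous_grad j).measurable.comp (measurable_playHistory x hs hst)

lemma measurable_playHistory_extrapolationRate (H : IsNoisyPlay μ ℓ L G σ q X₁ ξ X x g)
    {s t : ℕ} (hst : s ≤ t + 1) (j : Fin N) :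
    Measurable[playHistory x t] fun ω => extrapolationRate q (g · ω) s j :=
  measurable_extrapolationRate q fun _ hr hrs =>
    H.measurable_playHistory_feedback hr (by lia) j

lemma measurable_playHistory_noise (H : IsNoisyPlay μ ℓ L G σ q X₁ ξ X x g) {s t : ℕ}
    (hs : 1 ≤ s) (hst : s < t) (j : Fin N) : Measurable[playHistory x t] fun ω => ξ s ω j := by
  have hξ : (fun ω => ξ s ω j) = fun ω => g s ω j - grad ℓ j (x s ω) :=
    funext fun ω => eq_sub_of_add_eq' ((H.path ω).feedback s hs j).symm
  rw [hξ]
  exact (H.measurable_playHistory_feedback hs hst j).sub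
    (H.measurable_playHistory_grad hs hst.le j)

end IsNoisyPlay

end NoisyPlay

/-! ### Moments of the noise and of the feedback -/

section NormalizedNoise

variable {E : Type*} [NormedAddCommGroup E] [InnerProductSpace ℝ E]

/-- The martingale that appears in `‖∑ s ∈ Finset.Icc 1 T, ξ s‖ ^ 2`, expanded along the rounds,
when it is divided by the square root of the energy of the feedback `g`; `V` are the gradients. -/
noncomputable def normalizedNoise (g V ξ : ℕ → E) (T : ℕ) : ℝ :=
  ∑ t ∈ Finset.Icc 1 T, ⟪(√(energy g (t - 1)))⁻¹ • (∑ s ∈ Finset.Icc 1 (t - 1), ξ s - V t), ξ t⟫_ℝ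

variable {g V ξ : ℕ → E}

lemma sq_norm_sum_div_sqrt_energy_le (hg : ∀ t, 1 ≤ t → g t = V t + ξ t) (T : ℕ) :
    ‖∑ t ∈ Finset.Icc 1 T, ξ t‖ ^ 2 / √(energy g T) ≤
      ∑ t ∈ Finset.Icc 1 T, ‖g t‖ ^ 2 / √(energy g (t - 1)) + 2 * normalizedNoise g V ξ T := by
  induction T with
  | zero => simp [normalizedNoise]
  | succ n ih =>
    set S := ∑ t ∈ Finset.Icc 1 n, ξ t
    have hexpand : ‖S + ξ (n + 1)‖ ^ 2 =
        ‖S‖ ^ 2 + ‖g (n + 1)‖ ^ 2 - ‖V (n + 1)‖ ^ 2 + 2 * ⟪S - V (n + 1), ξ (n + 1)⟫_ℝ := by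
      rw [hg (n + 1) (by lia), norm_add_sq_real, norm_add_sq_real, inner_sub_left]
      ring
    have hnoise : normalizedNoise g V ξ (n + 1) = normalizedNoise g V ξ n +
        ⟪S - V (n + 1), ξ (n + 1)⟫_ℝ / √(energy g n) := by
      rw [normalizedNoise, Finset.sum_Icc_succ_top (by lia), real_inner_smul_left,
        inv_mul_eq_div]
      rfl
    rw [Finset.sum_Icc_succ_top (by lia), Finset.sum_Icc_succ_top (by lia), hnoise]
    calc ‖S + ξ (n + 1)‖ ^ 2 / √(energy g (n + 1))
        ≤ ‖S + ξ (n + 1)‖ ^ 2 / √(energy g n) :=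
          div_le_div_of_nonneg_left (sq_nonneg _) (Real.sqrt_pos.2 (energy_pos g n))
            (Real.sqrt_le_sqrt (energy_mono g n.le_succ))
      _ ≤ (‖S‖ ^ 2 + ‖g (n + 1)‖ ^ 2 + 2 * ⟪S - V (n + 1), ξ (n + 1)⟫_ℝ) / √(energy g n) := by
          rw [hexpand]
          gcongr
          linarith [sq_nonneg ‖V (n + 1)‖]
      _ ≤ _ := by
          rw [add_div, add_div, mul_div_assoc, Nat.add_sub_cancel]
          linarith

lemma norm_sum_noise_le {M : ℝ} (hg : ∀ t, 1 ≤ t → g t = V t + ξ t)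
    (hM : ∀ t, 1 ≤ t → ‖g t‖ ≤ M) (T : ℕ) :
    ‖∑ t ∈ Finset.Icc 1 T, ξ t‖ ≤
      (√(1 + 2 * M ^ 2) + 1) * √(energy g T) + normalizedNoise g V ξ T := by
  have hpos : 0 < √(energy g T) := Real.sqrt_pos.2 (energy_pos g T)
  have hsum : ∑ t ∈ Finset.Icc 1 T, ‖g t‖ ^ 2 / √(energy g (t - 1)) ≤
      2 * √(1 + 2 * M ^ 2) * √(energy g T) := by
    refine le_trans (Finset.sum_le_sum fun t _ => ?_) (sum_sq_div_sqrt_energy_le hM T)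
    exact div_le_div_of_nonneg_left (sq_nonneg _) (Real.sqrt_pos.2 (energy_pos g _))
      (Real.sqrt_le_sqrt (energy_mono g (by lia)))
  have hamgm : 2 * ‖∑ t ∈ Finset.Icc 1 T, ξ t‖ ≤
      ‖∑ t ∈ Finset.Icc 1 T, ξ t‖ ^ 2 / √(energy g T) + √(energy g T) := by
    rw [div_add' _ _ _ hpos.ne', le_div_iff₀ hpos]
    linarith [two_mul_le_add_sq ‖∑ t ∈ Finset.Icc 1 T, ξ t‖ √(energy g T)]
  linarith [sq_norm_sum_div_sqrt_energy_le hg T]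

end NormalizedNoise

section Moments

variable {N : ℕ} {d : Fin N → ℕ} {Ω : Type*} [m₀ : MeasurableSpace Ω] {μ : Measure Ω}
  {ℓ : Fin N → Profile d → ℝ} {L : ℝ≥0} {G σ q : ℝ} {X₁ : Profile d}
  {ξ X x g : ℕ → Ω → Profile d} {j : Fin N} {t : ℕ}

lemma memLp_energy {E : Type*} [NormedAddCommGroup E] {g : ℕ → Ω → E}
    (hg : ∀ s, 1 ≤ s → MemLp (g s) ⊤ μ) (t : ℕ) : MemLp (fun ω => energy (g · ω) t) ⊤ μ :=
  (memLp_top_const (1 : ℝ)).add <| memLp_finsetSum _ fun s hs =>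
    memLp_top_norm_sq (hg s (Finset.mem_Icc.1 hs).1)

namespace IsNoisyPlay

lemma ae_isBoundedRun (H : IsNoisyPlay μ ℓ L G σ q X₁ ξ X x g) :
    ∀ᵐ ω ∂μ, IsBoundedRun ℓ q X₁ (G + σ) (ξ · ω) (X · ω) (x · ω) (g · ω) := by
  have hnoise : ∀ᵐ ω ∂μ, ∀ t, 1 ≤ t → ∀ j, ‖ξ t ω j‖ ≤ σ :=
    ae_all_iff.2 fun t => Filter.eventually_imp_distrib_left.2 fun ht =>
      ae_all_iff.2 fun j => H.noise.bounded t ht j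
  filter_upwards [hnoise] with ω hω
  refine ⟨H.path ω, H.le_quarter, fun t ht j => ?_⟩
  rw [(H.path ω).feedback t ht j]
  exact (norm_add_le _ _).trans (add_le_add (H.norm_grad_le _ _) (hω t ht j))

lemma memLp_noise (H : IsNoisyPlay μ ℓ L G σ q X₁ ξ X x g) (ht : 1 ≤ t) :
    MemLp (fun ω => ξ t ω j) ⊤ μ :=
  memLp_top_of_bound
    (measurable_profile_apply (H.noise.measurable t ht) j).aestronglyMeasurable σ
    (H.noise.bounded t ht j)

lemma memLp_grad (H : IsNoisyPlay μ ℓ L G σ q X₁ ξ X x g) (ht : 1 ≤ t) :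
    MemLp (fun ω => grad ℓ j (x t ω)) ⊤ μ :=
  memLp_top_of_bound
    ((H.game.continuous_grad j).measurable.comp (H.measurable_action ht)).aestronglyMeasurable G
    (.of_forall fun _ => H.norm_grad_le _ _)

lemma memLp_feedback (H : IsNoisyPlay μ ℓ L G σ q X₁ ξ X x g) (ht : 1 ≤ t) :
    MemLp (fun ω => g t ω j) ⊤ μ := by
  simp only [(H.path _).feedback t ht j]
  exact (H.memLp_grad ht).add (H.memLp_noise ht)

lemma memLp_rpow_energy (H : IsNoisyPlay μ ℓ L G σ q X₁ ξ X x g) (j : Fin N) (t : ℕ) {r : ℝ}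
    (hr : r ≤ 1) : MemLp (fun ω => energy (g · ω j) t ^ r) ⊤ μ := by
  have henergy : MemLp (fun ω => energy (g · ω j) t) ⊤ μ :=
    memLp_energy (g := fun s ω => g s ω j) (fun _ hs => H.memLp_feedback hs) t
  refine henergy.mono (henergy.aestronglyMeasurable.aemeasurable.pow_const r).aestronglyMeasurable
    (.of_forall fun ω => ?_)
  have hone : 1 ≤ energy (g · ω j) t := one_le_energy _ t
  rw [Real.norm_of_nonneg (by positivity), Real.norm_of_nonneg (by positivity)]
  exact (Real.rpow_le_rpow_of_exponent_le hone hr).trans_eq (Real.rpow_one _)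

lemma memLp_sqrt_energy (H : IsNoisyPlay μ ℓ L G σ q X₁ ξ X x g) (j : Fin N) (t : ℕ) :
    MemLp (fun ω => √(energy (g · ω j) t)) ⊤ μ := by
  simp only [Real.sqrt_eq_rpow]
  exact H.memLp_rpow_energy j t (by norm_num)

lemma memLp_extrapolationRate (H : IsNoisyPlay μ ℓ L G σ q X₁ ξ X x g) (j : Fin N) (t : ℕ) :
    MemLp (fun ω => extrapolationRate q (g · ω) t j) ⊤ μ :=
  H.memLp_rpow_energy j (t - 2) (by linarith [H.le_quarter])

lemma memLp_inv_sqrt_energy (H : IsNoisyPlay μ ℓ L G σ q X₁ ξ X x g) (j : Fin N) (t : ℕ) :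
    MemLp (fun ω => (√(energy (g · ω j) t))⁻¹) ⊤ μ := by
  simp only [Real.sqrt_eq_rpow, ← Real.rpow_neg (energy_pos _ _).le]
  exact H.memLp_rpow_energy j t (by norm_num)

lemma memLp_iterate (H : IsNoisyPlay μ ℓ L G σ q X₁ ξ X x g) (ht : 1 ≤ t) :
    MemLp (fun ω => X t ω j) ⊤ μ := by
  rcases ht.eq_or_lt with rfl | ht1
  · simpa only [(H.path _).init] using memLp_top_const (X₁ j)
  · obtain ⟨n, hn, rfl⟩ : ∃ n, 1 ≤ n ∧ n + 1 = t := ⟨t - 1, by lia, by lia⟩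
    have hmeas : Measurable fun ω => updateRate (g · ω) (X · ω) (n + 1) j :=
      measurable_updateRate (fun s hs _ => H.measurable_feedback hs j) fun s hs _ =>
        measurable_iterate H.path hs fun r hr _ => H.measurable_feedback hr j
    have hrate : MemLp (fun ω => updateRate (g · ω) (X · ω) (n + 1) j) ⊤ μ :=
      memLp_top_of_bound hmeas.aestronglyMeasurable 1 <| .of_forall fun ω => by
        rw [Real.norm_of_nonneg (updateRate_pos _ _ _ _).le, updateRate_eq]
        exact inv_le_one_of_one_le₀ (one_le_invRate _ _ _)
    simp only [(H.path _).update n hn j]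
    exact (memLp_top_const (X₁ j)).sub ((memLp_finsetSum _ fun s hs =>
      H.memLp_feedback (Finset.mem_Icc.1 hs).1).smul hrate)

lemma memLp_action (H : IsNoisyPlay μ ℓ L G σ q X₁ ξ X x g) (ht : 1 ≤ t) :
    MemLp (fun ω => x t ω j) ⊤ μ := by
  have hlast : MemLp (fun ω => g (t - 1) ω j) ⊤ μ := by
    rcases ht.eq_or_lt with rfl | ht1
    · have hzero : (fun ω => g (1 - 1) ω j) = 0 := funext fun ω =>
        congrArg (· j) (H.path ω).feedback_zero
      exact hzero ▸ MemLp.zero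
    · exact H.memLp_feedback (by lia)
  simp only [(H.path _).play t ht j]
  exact (H.memLp_iterate ht).sub (hlast.smul (H.memLp_extrapolationRate j t))

variable [IsFiniteMeasure μ]

lemma isCentered_inner_noise (H : IsNoisyPlay μ ℓ L G σ q X₁ ξ X x g) (ht : 1 ≤ t)
    {f : Ω → EuclideanSpace ℝ (Fin (d j))} (hf : Measurable[playHistory x t] f)
    (hf_mem : MemLp f ⊤ μ) : IsCentered μ fun ω => ⟪f ω, ξ t ω j⟫_ℝ :=
  isCentered_inner_of_condExp_eq_zero (H.playHistory_le t) hf.stronglyMeasurable hf_mem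
    ((H.memLp_noise ht).integrable le_top) (H.noise.unbiased t ht j)

lemma isCentered_noiseTerm (H : IsNoisyPlay μ ℓ L G σ q X₁ ξ X x g) (j : Fin N)
    (p : EuclideanSpace ℝ (Fin (d j))) (T : ℕ) :
    IsCentered μ fun ω => noiseTerm ℓ q (ξ · ω) (x · ω) (g · ω) j p T := by
  refine .sub (.sum fun t ht => ?_) (.sum fun s hs => ?_)
  · have ht1 := (Finset.mem_Icc.1 ht).1
    exact H.isCentered_inner_noise ht1
      (measurable_const.sub (measurable_profile_apply (measurable_playHistory x ht1 le_rfl) j))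
      ((memLp_top_const p).sub (H.memLp_action ht1))
  · have hs1 := (Finset.mem_Ico.1 hs).1
    simp only [mul_add, ← real_inner_smul_left]
    refine .add ?_ ?_
    · exact H.isCentered_inner_noise (by lia)
        ((H.measurable_playHistory_extrapolationRate (by lia) j).smul
          (H.measurable_playHistory_feedback hs1 s.lt_succ_self j))
        ((H.memLp_feedback hs1).smul (H.memLp_extrapolationRate j (s + 1)))
    · exact H.isCentered_inner_noise hs1
        ((H.measurable_playHistory_extrapolationRate le_rfl j).smul
          (H.measurable_playHistory_grad hs1 le_rfl j))
        ((H.memLp_grad hs1).smul (H.memLp_extrapolationRate j (s + 1)))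

lemma isCentered_normalizedNoise (H : IsNoisyPlay μ ℓ L G σ q X₁ ξ X x g) (j : Fin N) (T : ℕ) :
    IsCentered μ fun ω =>
      normalizedNoise (g · ω j) (fun t => grad ℓ j (x t ω)) (ξ · ω j) T := by
  refine .sum fun t ht => ?_
  have ht1 := (Finset.mem_Icc.1 ht).1
  have hinv : Measurable[playHistory x t] fun ω => (√(energy (g · ω j) (t - 1)))⁻¹ :=
    (measurable_energy (g := fun s ω => g s ω j) fun s hs hst =>
      H.measurable_playHistory_feedback hs (by lia) j).sqrt.inv
  have hsum : Measurable[playHistory x t] fun ω => ∑ s ∈ Finset.Icc 1 (t - 1), ξ s ω j :=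
    Finset.measurable_fun_sum _ fun s hs => by
      obtain ⟨hs1, hst⟩ := Finset.mem_Icc.1 hs
      exact H.measurable_playHistory_noise hs1 (by lia) j
  exact H.isCentered_inner_noise ht1
    (hinv.smul (hsum.sub (H.measurable_playHistory_grad ht1 le_rfl j)))
    (((memLp_finsetSum _ fun s hs => H.memLp_noise (Finset.mem_Icc.1 hs).1).sub
      (H.memLp_grad ht1)).smul (H.memLp_inv_sqrt_energy j (t - 1)))

end IsNoisyPlay

end Moments

section MultiplicativeNoise

variable {N : ℕ} {d : Fin N → ℕ} {Ω : Type*} [MeasurableSpace Ω] {μ : Measure Ω}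
  {ℓ : Fin N → Profile d → ℝ} {L : ℝ≥0} {G σ σM q : ℝ} {X₁ : Profile d}
  {ξ X x g : ℕ → Ω → Profile d} {j : Fin N} {t : ℕ}

namespace IsNoisyPlay

lemma memLp_extrapolationGain (H : IsNoisyPlay μ ℓ L G σ q X₁ ξ X x g) (j : Fin N) (T : ℕ) :
    MemLp (fun ω => extrapolationGain ℓ q (x · ω) (g · ω) j T) ⊤ μ :=
  memLp_finsetSum _ fun s hs => (memLp_top_norm_sq (H.memLp_grad (Finset.mem_Ico.1 hs).1)).mul'
    (H.memLp_extrapolationRate j (s + 1))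

variable [IsFiniteMeasure μ]

lemma integral_mul_norm_feedback_sq (H : IsNoisyPlay μ ℓ L G σ q X₁ ξ X x g) (ht : 1 ≤ t)
    (j : Fin N) {w : Ω → ℝ} (hw : Measurable[playHistory x t] w) (hw_mem : MemLp w ⊤ μ) :
    ∫ ω, w ω * ‖g t ω j‖ ^ 2 ∂μ =
      ∫ ω, w ω * ‖grad ℓ j (x t ω)‖ ^ 2 ∂μ + ∫ ω, w ω * ‖ξ t ω j‖ ^ 2 ∂μ := by
  have hcross : IsCentered μ fun ω => ⟪w ω • grad ℓ j (x t ω), ξ t ω j⟫_ℝ :=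
    H.isCentered_inner_noise ht (hw.smul (H.measurable_playHistory_grad ht le_rfl j))
      ((H.memLp_grad ht).smul hw_mem)
  have hgrad : Integrable (fun ω => w ω * ‖grad ℓ j (x t ω)‖ ^ 2) μ :=
    ((memLp_top_norm_sq (H.memLp_grad ht)).mul' hw_mem).integrable le_top
  have hnoise : Integrable (fun ω => w ω * ‖ξ t ω j‖ ^ 2) μ :=
    ((memLp_top_norm_sq (H.memLp_noise ht)).mul' hw_mem).integrable le_top
  calc ∫ ω, w ω * ‖g t ω j‖ ^ 2 ∂μ = ∫ ω, (w ω * ‖grad ℓ j (x t ω)‖ ^ 2 +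
        w ω * ‖ξ t ω j‖ ^ 2 + 2 * ⟪w ω • grad ℓ j (x t ω), ξ t ω j⟫_ℝ) ∂μ := by
        congr with ω
        rw [(H.path ω).feedback t ht j, norm_add_sq_real, real_inner_smul_left]
        ring
    _ = _ := by
        rw [integral_add (hgrad.fun_add hnoise) (hcross.1.const_mul 2),
          integral_add hgrad hnoise, integral_const_mul, hcross.2, mul_zero, add_zero]

lemma integral_mul_norm_feedback_sq_le (H : IsNoisyPlay μ ℓ L G σ q X₁ ξ X x g)
    (hξ : HasVarianceControl μ ℓ ξ x 0 σM) (ht : 1 ≤ t) (j : Fin N) {w : Ω → ℝ}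
    (hw : Measurable[playHistory x t] w) (hw0 : ∀ ω, 0 ≤ w ω) (hw_mem : MemLp w ⊤ μ) :
    ∫ ω, w ω * ‖g t ω j‖ ^ 2 ∂μ ≤ (1 + σM ^ 2) * ∫ ω, w ω * ‖grad ℓ j (x t ω)‖ ^ 2 ∂μ := by
  have hgrad : Integrable (fun ω => ‖grad ℓ j (x t ω)‖ ^ 2) μ :=
    (memLp_top_norm_sq (H.memLp_grad ht)).integrable le_top
  have hle := integral_mul_le_of_condExp_le (H.playHistory_le t) hw.stronglyMeasurable hw0 hw_mem
    ((memLp_top_norm_sq (H.memLp_noise ht)).integrable le_top)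
    ((integrable_const (0 ^ 2 : ℝ)).add (hgrad.const_mul (σM ^ 2))) (hξ t ht j)
  have hcomm : ∀ ω, w ω * (0 ^ 2 + σM ^ 2 * ‖grad ℓ j (x t ω)‖ ^ 2) =
      σM ^ 2 * (w ω * ‖grad ℓ j (x t ω)‖ ^ 2) := fun ω => by ring
  simp only [Pi.add_apply, hcomm, integral_const_mul] at hle
  rw [H.integral_mul_norm_feedback_sq ht j hw hw_mem]
  linarith

lemma integral_sum_mul_norm_feedback_sq_le (H : IsNoisyPlay μ ℓ L G σ q X₁ ξ X x g)
    (hξ : HasVarianceControl μ ℓ ξ x 0 σM) (j : Fin N) (T : ℕ) :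
    ∫ ω, ∑ s ∈ Finset.Ico 1 T, extrapolationRate q (g · ω) (s + 1) j * ‖g s ω j‖ ^ 2 ∂μ ≤
      (1 + σM ^ 2) * ∫ ω, extrapolationGain ℓ q (x · ω) (g · ω) j T ∂μ := by
  unfold extrapolationGain optimisticGain
  rw [integral_finsetSum, integral_finsetSum, Finset.mul_sum]
  · refine Finset.sum_le_sum fun s hs => ?_
    exact H.integral_mul_norm_feedback_sq_le hξ (Finset.mem_Ico.1 hs).1 j
      (H.measurable_playHistory_extrapolationRate le_rfl j)
      (fun ω => (extrapolationRate_pos _ _ _ _).le) (H.memLp_extrapolationRate j (s + 1))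
  · exact fun s hs => ((memLp_top_norm_sq (H.memLp_grad (Finset.mem_Ico.1 hs).1)).mul'
      (H.memLp_extrapolationRate j (s + 1))).integrable le_top
  · exact fun s hs => ((memLp_top_norm_sq (H.memLp_feedback (Finset.mem_Ico.1 hs).1)).mul'
      (H.memLp_extrapolationRate j (s + 1))).integrable le_top

end IsNoisyPlay

end MultiplicativeNoise

section EnergyBounds

variable {N : ℕ} {d : Fin N → ℕ} {Ω : Type*} [MeasurableSpace Ω] {μ : Measure Ω}
  [IsProbabilityMeasure μ] {ℓ : Fin N → Profile d → ℝ} {L : ℝ≥0} {G σ σM q K : ℝ} {X₁ : Profile d}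
  {ξ X x g : ℕ → Ω → Profile d} {T : ℕ}

namespace IsNoisyPlay

lemma integral_rpow_energy_le (H : IsNoisyPlay μ ℓ L G σ q X₁ ξ X x g)
    (hξ : HasVarianceControl μ ℓ ξ x 0 σM) (j : Fin N) (T : ℕ) :
    ∫ ω, energy (g · ω j) T ^ (1 / 2 + q) ∂μ ≤
      (1 + σM ^ 2) * ∫ ω, extrapolationGain ℓ q (x · ω) (g · ω) j T ∂μ +
        (1 + (G + σ) ^ 2) := by
  have hsum : Integrable (fun ω => ∑ s ∈ Finset.Ico 1 T,
      extrapolationRate q (g · ω) (s + 1) j * ‖g s ω j‖ ^ 2) μ :=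
    integrable_finsetSum _ fun s hs =>
      ((memLp_top_norm_sq (H.memLp_feedback (Finset.mem_Ico.1 hs).1)).mul'
        (H.memLp_extrapolationRate j (s + 1))).integrable le_top
  have hpower : Integrable (fun ω => energy (g · ω j) T ^ (1 / 2 + q)) μ :=
    (H.memLp_rpow_energy j T (by linarith [H.le_quarter])).integrable le_top
  have hle : ∀ᵐ ω ∂μ, energy (g · ω j) T ^ (1 / 2 + q) ≤ ∑ s ∈ Finset.Ico 1 T,
      extrapolationRate q (g · ω) (s + 1) j * ‖g s ω j‖ ^ 2 + (1 + (G + σ) ^ 2) := by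
    filter_upwards [H.ae_isBoundedRun] with ω hω
    exact rpow_cumul_le_sum_add (fun _ => sq_nonneg _)
      (fun t ht => pow_le_pow_left₀ (norm_nonneg _) (hω.norm_feedback_le t ht j) 2)
      (by linarith [H.le_quarter]) T
  refine (integral_mono_ae hpower (hsum.add (integrable_const _)) hle).trans ?_
  rw [integral_add' hsum (integrable_const _), integral_const, probReal_univ, one_smul]
  gcongr
  exact H.integral_sum_mul_norm_feedback_sq_le hξ j T

lemma integral_sqrt_energy_le_sqrt (H : IsNoisyPlay μ ℓ L G σ q X₁ ξ X x g) (j : Fin N)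
    (hT : 1 ≤ T) : ∫ ω, √(energy (g · ω j) T) ∂μ ≤ √(1 + (G + σ) ^ 2) * √T := by
  have hle : ∀ᵐ ω ∂μ, √(energy (g · ω j) T) ≤ √(1 + (G + σ) ^ 2) * √T := by
    filter_upwards [H.ae_isBoundedRun] with ω hω
    have hsum : ∑ s ∈ Finset.Icc 1 T, ‖g s ω j‖ ^ 2 ≤ T * (G + σ) ^ 2 := by
      refine (Finset.sum_le_card_nsmul _ _ ((G + σ) ^ 2) fun s hs => ?_).trans_eq (by simp)
      gcongr
      exact hω.norm_feedback_le s (Finset.mem_Icc.1 hs).1 j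
    rw [← Real.sqrt_mul (by positivity)]
    have hT' : (1 : ℝ) ≤ T := mod_cast hT
    exact Real.sqrt_le_sqrt (by unfold energy cumul; linarith)
  calc ∫ ω, √(energy (g · ω j) T) ∂μ ≤ ∫ _, √(1 + (G + σ) ^ 2) * √T ∂μ :=
        integral_mono_ae ((H.memLp_sqrt_energy j T).integrable le_top) (integrable_const _) hle
    _ = _ := by rw [integral_const, probReal_univ, one_smul]

lemma mul_integral_sqrt_energy_le (H : IsNoisyPlay μ ℓ L G σ q X₁ ξ X x g) (hq : 0 < q)
    (hK : 0 < K) (j : Fin N) (T : ℕ) :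
    K * ∫ ω, √(energy (g · ω j) T) ∂μ ≤ (∫ ω, energy (g · ω j) T ^ (1 / 2 + q) ∂μ) / 2 +
      K * Real.exp (Real.log (2 * K) * (1 / (2 * q))) := by
  have hpower : Integrable (fun ω => energy (g · ω j) T ^ (1 / 2 + q)) μ :=
    (H.memLp_rpow_energy j T (by linarith [H.le_quarter])).integrable le_top
  have hmono := integral_mono (((H.memLp_sqrt_energy j T).integrable le_top).const_mul K)
    ((hpower.div_const 2).add (integrable_const _))
    fun ω => mul_sqrt_le_rpow_add hK (energy_pos (g · ω j) T) hq
  rwa [integral_add' (hpower.div_const 2) (integrable_const _), integral_const_mul,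
    integral_div, integral_const, probReal_univ, one_smul] at hmono

/-- The bound on the gains is linear in the square roots of the energies, while under
multiplicative noise the gains dominate larger powers of the energies. -/
lemma sum_integral_sqrt_energy_le (H : IsNoisyPlay μ ℓ L G σ q X₁ ξ X x g)
    (hξ : HasVarianceControl μ ℓ ξ x 0 σM) (hq : 0 < q) (hK : 0 ≤ K)
    (hgain : ∑ j, ∫ ω, extrapolationGain ℓ q (x · ω) (g · ω) j T ∂μ ≤
      K * (1 + ∑ j, ∫ ω, √(energy (g · ω j) T) ∂μ)) :
    ∑ j, ∫ ω, √(energy (g · ω j) T) ∂μ ≤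
      1 + 2 * (N * Real.exp (Real.log (2 * ((1 + σM ^ 2) * K + N * (1 + (G + σ) ^ 2) + 1)) *
        (1 / (2 * q)))) := by
  set R := ∑ j, ∫ ω, √(energy (g · ω j) T) ∂μ with hR
  set K' := (1 + σM ^ 2) * K + N * (1 + (G + σ) ^ 2) + 1 with hK'_def
  set e := Real.exp (Real.log (2 * K') * (1 / (2 * q)))
  have hR0 : 0 ≤ R := Finset.sum_nonneg fun j _ => integral_nonneg fun _ => Real.sqrt_nonneg _
  have hK' : 0 < K' := by positivity
  have habsorb : ∀ j, K' * ∫ ω, √(energy (g · ω j) T) ∂μ ≤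
      (∫ ω, energy (g · ω j) T ^ (1 / 2 + q) ∂μ) / 2 + K' * e :=
    fun j => H.mul_integral_sqrt_energy_le hq hK' j T
  have hsum : K' * R ≤ (∑ j, ∫ ω, energy (g · ω j) T ^ (1 / 2 + q) ∂μ) / 2 + N * (K' * e) := by
    simpa [hR, Finset.mul_sum, Finset.sum_add_distrib, Finset.sum_div] using
      Finset.sum_le_sum fun j (_ : j ∈ Finset.univ) => habsorb j
  have hpowers : ∑ j, ∫ ω, energy (g · ω j) T ^ (1 / 2 + q) ∂μ ≤
      (1 + σM ^ 2) * (K * (1 + R)) + N * (1 + (G + σ) ^ 2) := by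
    refine (Finset.sum_le_sum fun j _ => H.integral_rpow_energy_le hξ j T).trans ?_
    rw [Finset.sum_add_distrib, ← Finset.mul_sum, Finset.sum_const, Finset.card_univ,
      Fintype.card_fin, nsmul_eq_mul]
    gcongr
  have hlinear : (1 + σM ^ 2) * (K * (1 + R)) + N * (1 + (G + σ) ^ 2) ≤ K' * (1 + R) := by
    have hnoise : 0 ≤ N * (1 + (G + σ) ^ 2) * R := by positivity
    rw [hK'_def]
    linarith
  refine le_of_mul_le_mul_left ?_ hK'
  linarith

end IsNoisyPlay

end EnergyBounds

/-! ### Regret in expectation -/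

section Integrability

variable {N : ℕ} {d : Fin N → ℕ} {Ω : Type*} [MeasurableSpace Ω] {μ : Measure Ω}
  {ℓ : Fin N → Profile d → ℝ} {L : ℝ≥0} {G σ q : ℝ} {X₁ : Profile d}
  {ξ X x g : ℕ → Ω → Profile d}

namespace IsNoisyPlay

lemma measurable_linRegret (H : IsNoisyPlay μ ℓ L G σ q X₁ ξ X x g) (i : Fin N) (T : ℕ)
    (p : EuclideanSpace ℝ (Fin (d i))) : Measurable fun ω => linRegret ℓ i (x · ω) T p :=
  Finset.measurable_fun_sum _ fun t ht => by
    have haction := H.measurable_action (Finset.mem_Icc.1 ht).1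
    exact ((H.game.continuous_grad i).measurable.comp haction).inner
      ((measurable_profile_apply haction i).sub measurable_const)

lemma measurable_regret (H : IsNoisyPlay μ ℓ L G σ q X₁ ξ X x g) (i : Fin N) (T : ℕ)
    (p : EuclideanSpace ℝ (Fin (d i))) : Measurable fun ω => regret ℓ i (x · ω) T p :=
  Finset.measurable_fun_sum _ fun _ ht =>
    (H.game.continuous_sub_deviate i p).measurable.comp
      (H.measurable_action (Finset.mem_Icc.1 ht).1)

lemma sum_norm_action_sub_le (H : IsNoisyPlay μ ℓ L G σ q X₁ ξ X x g) {i : Fin N}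
    {p : EuclideanSpace ℝ (Fin (d i))} {ρ : ℝ} (hp : ‖p‖ ≤ ρ) (T : ℕ) (ω : Ω) :
    ∑ t ∈ Finset.Icc 1 T, G * ‖x t ω i - p‖ ≤ ∑ t ∈ Finset.Icc 1 T, G * (‖x t ω i‖ + ρ) := by
  have hG : 0 ≤ G := (norm_nonneg _).trans (H.norm_grad_le i X₁)
  gcongr
  exact (norm_sub_le _ _).trans (by gcongr)

variable [IsFiniteMeasure μ]

lemma integrable_sum_norm_action_add (H : IsNoisyPlay μ ℓ L G σ q X₁ ξ X x g) (i : Fin N)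
    (T : ℕ) (ρ : ℝ) : Integrable (fun ω => ∑ t ∈ Finset.Icc 1 T, G * (‖x t ω i‖ + ρ)) μ :=
  integrable_finsetSum _ fun _ ht =>
    (((H.memLp_action (Finset.mem_Icc.1 ht).1).norm.integrable le_top).add
      (integrable_const ρ)).const_mul G

lemma integrable_linRegret (H : IsNoisyPlay μ ℓ L G σ q X₁ ξ X x g) (i : Fin N) (T : ℕ)
    (p : EuclideanSpace ℝ (Fin (d i))) : Integrable (fun ω => linRegret ℓ i (x · ω) T p) μ :=
  (H.integrable_sum_norm_action_add i T ‖p‖).mono'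
    (H.measurable_linRegret i T p).aestronglyMeasurable (.of_forall fun ω =>
      (abs_linRegret_le i _ T H.norm_grad_le p).trans (H.sum_norm_action_sub_le le_rfl T ω))

lemma integrable_regret (H : IsNoisyPlay μ ℓ L G σ q X₁ ξ X x g) (i : Fin N) (T : ℕ)
    (p : EuclideanSpace ℝ (Fin (d i))) : Integrable (fun ω => regret ℓ i (x · ω) T p) μ :=
  (H.integrable_sum_norm_action_add i T ‖p‖).mono'
    (H.measurable_regret i T p).aestronglyMeasurable (.of_forall fun ω =>
      (H.game.abs_regret_le i _ T H.norm_grad_le p).trans (H.sum_norm_action_sub_le le_rfl T ω))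

lemma expectationSupLE (H : IsNoisyPlay μ ℓ L G σ q X₁ ξ X x g) {i : Fin N} {ρ : ℝ}
    (hρ : 0 ≤ ρ) {P : Set (EuclideanSpace ℝ (Fin (d i)))} (hP : ∀ p ∈ P, ‖p‖ ≤ ρ) {T : ℕ}
    {Z : Ω → ℝ} {c : ℝ} (hZ : Integrable Z μ)
    (hRZ : ∀ᵐ ω ∂μ, ∀ p ∈ P, linRegret ℓ i (x · ω) T p ≤ Z ω) (hZc : ∫ ω, Z ω ∂μ ≤ c)
    (hc : 0 ≤ c) :
    ExpectationSupLE μ P (fun p ω => linRegret ℓ i (x · ω) T p) c ∧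
      ExpectationSupLE μ P (fun p ω => regret ℓ i (x · ω) T p) c := by
  have hb := H.integrable_sum_norm_action_add i T ρ
  have hG : 0 ≤ G := (norm_nonneg _).trans (H.norm_grad_le i X₁)
  have hb0 : ∀ ω, 0 ≤ ∑ t ∈ Finset.Icc 1 T, G * (‖x t ω i‖ + ρ) := fun ω => by positivity
  constructor
  · exact expectationSupLE_of_le (fun ω => continuous_linRegret i _ T)
      (H.measurable_linRegret i T) hb hb0 (fun ω p hp =>
        (abs_linRegret_le i _ T H.norm_grad_le p).trans (H.sum_norm_action_sub_le (hP p hp) T ω))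
      hZ hRZ hZc hc
  · refine expectationSupLE_of_le (fun ω => H.game.continuous_regret i _ T)
      (H.measurable_regret i T) hb hb0 (fun ω p hp =>
        (H.game.abs_regret_le i _ T H.norm_grad_le p).trans
          (H.sum_norm_action_sub_le (hP p hp) T ω)) hZ ?_ hZc hc
    filter_upwards [hRZ] with ω hω p hp using (H.game.regret_le_linRegret i _ T p).trans (hω p hp)

end IsNoisyPlay

end Integrability

section Regret

variable {N : ℕ} {d : Fin N → ℕ} {ℓ : Fin N → Profile d → ℝ} {L : ℝ≥0} {G ρ : ℝ} {z : Profile d}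

namespace IsNoisyPlay

lemma integral_const_mul_one_add_sum_sqrt_energy {Ω : Type*} [MeasurableSpace Ω] {μ : Measure Ω}
    [IsProbabilityMeasure μ] {σ q : ℝ} {X₁ : Profile d} {ξ X x g : ℕ → Ω → Profile d}
    (H : IsNoisyPlay μ ℓ L G σ q X₁ ξ X x g) (K : ℝ) (T : ℕ) :
    Integrable (fun ω => K * (1 + ∑ k, √(energy (g · ω k) T))) μ ∧
      ∫ ω, K * (1 + ∑ k, √(energy (g · ω k) T)) ∂μ =
        K * (1 + ∑ k, ∫ ω, √(energy (g · ω k) T) ∂μ) := by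
  have henergy : ∀ k ∈ Finset.univ, Integrable (fun ω => √(energy (g · ω k) T)) μ :=
    fun k _ => (H.memLp_sqrt_energy k T).integrable le_top
  have hsum := integrable_finsetSum _ henergy
  refine ⟨((integrable_const 1).add hsum).const_mul K, ?_⟩
  rw [integral_const_mul, integral_add (integrable_const 1) hsum, integral_finsetSum _ henergy,
    integral_const, probReal_univ, one_smul]

lemma exists_sum_integral_extrapolationGain_le (hL : ∀ i, LipschitzWith L (grad ℓ i))
    (hG : ∀ i x, ‖grad ℓ i x‖ ≤ G) (hz : ∀ x, 0 ≤ ∑ i, ⟪grad ℓ i x, x i - z i⟫_ℝ)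
    (X₁ : Profile d) (σ : ℝ) :
    ∃ K, 0 ≤ K ∧ ∀ {Ω : Type*} [MeasurableSpace Ω] {μ : Measure Ω} [IsProbabilityMeasure μ]
      {q : ℝ} {ξ X x g : ℕ → Ω → Profile d}, IsNoisyPlay μ ℓ L G σ q X₁ ξ X x g → ∀ T,
      ∑ j, ∫ ω, extrapolationGain ℓ q (x · ω) (g · ω) j T ∂μ ≤
        K * (1 + ∑ j, ∫ ω, √(energy (g · ω j) T) ∂μ) := by
  obtain ⟨K, hK, hgain⟩ := IsBoundedRun.exists_sum_extrapolationGain_add_le hL hG hz X₁ (G + σ)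
  refine ⟨K, hK, fun {Ω _ μ _ q ξ X x g} H T => ?_⟩
  have hgain_int : ∀ j ∈ Finset.univ,
      Integrable (fun ω => extrapolationGain ℓ q (x · ω) (g · ω) j T) μ :=
    fun j _ => (H.memLp_extrapolationGain j T).integrable le_top
  have hnoise : IsCentered μ fun ω => ∑ j, noiseTerm ℓ q (ξ · ω) (x · ω) (g · ω) j (z j) T :=
    .sum fun j _ => H.isCentered_noiseTerm j (z j) T
  obtain ⟨henergy_int, henergy⟩ := H.integral_const_mul_one_add_sum_sqrt_energy K T
  rw [← integral_finsetSum _ hgain_int, ← henergy, ← zero_add (∫ ω, K * _ ∂μ), ← hnoise.2,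
    ← integral_add hnoise.1 henergy_int]
  refine integral_mono_ae (integrable_finsetSum _ hgain_int) (hnoise.1.add henergy_int) ?_
  filter_upwards [H.ae_isBoundedRun] with ω hω
  have hpath : 0 ≤ ∑ j, pathVariation (X · ω j) T :=
    Finset.sum_nonneg fun j _ => pathVariation_nonneg _ T
  exact (le_add_of_nonneg_right (by positivity)).trans (hgain hω T)

lemma exists_linRegret_le_isCentered_add (hL : ∀ i, LipschitzWith L (grad ℓ i))
    (hG : ∀ i x, ‖grad ℓ i x‖ ≤ G) (hz : ∀ x, 0 ≤ ∑ i, ⟪grad ℓ i x, x i - z i⟫_ℝ)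
    (X₁ : Profile d) (σ : ℝ) (hρ : 0 ≤ ρ) :
    ∃ K, 0 ≤ K ∧ ∀ {Ω : Type*} [MeasurableSpace Ω] {μ : Measure Ω} [IsProbabilityMeasure μ]
      {q : ℝ} {ξ X x g : ℕ → Ω → Profile d}, IsNoisyPlay μ ℓ L G σ q X₁ ξ X x g → ∀ T i,
      ∃ D, IsCentered μ D ∧ ∀ᵐ ω ∂μ, ∀ p, ‖p‖ ≤ ρ →
        linRegret ℓ i (x · ω) T p ≤ D ω + K * (1 + ∑ j, √(energy (g · ω j) T)) := by
  obtain ⟨K, c, hK, hregret⟩ := IsBoundedRun.exists_linRegret_le hL hG hz X₁ (G + σ) ρ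
  set κ := √(1 + 2 * (G + σ) ^ 2) + 1
  refine ⟨K + ρ * κ, by positivity, fun {Ω _ μ _ q ξ X x g} H T i => ?_⟩
  refine ⟨_, ((H.isCentered_noiseTerm i 0 T).add
    ((H.isCentered_normalizedNoise i T).const_mul ρ)).add
    ((IsCentered.sum fun k (_ : k ∈ Finset.univ) =>
      H.isCentered_noiseTerm k (z k) T).const_mul c), ?_⟩
  filter_upwards [H.ae_isBoundedRun] with ω hω p hp
  have hcomparator : noiseTerm ℓ q (ξ · ω) (x · ω) (g · ω) i p T ≤
      noiseTerm ℓ q (ξ · ω) (x · ω) (g · ω) i 0 T + ρ * ‖∑ t ∈ Finset.Icc 1 T, ξ t ω i‖ :=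
    optimisticNoise_le_add_norm hp T
  have hnoise := mul_le_mul_of_nonneg_left (norm_sum_noise_le (fun t ht => hω.feedback t ht i)
    (fun t ht => hω.norm_feedback_le t ht i) T) hρ
  have henergy : √(energy (g · ω i) T) ≤ 1 + ∑ j, √(energy (g · ω j) T) :=
    (Finset.single_le_sum (f := fun j => √(energy (g · ω j) T)) (fun j _ => Real.sqrt_nonneg _)
      (Finset.mem_univ i)).trans (by linarith)
  have hweighted := mul_le_mul_of_nonneg_left henergy (show 0 ≤ ρ * κ by positivity)
  linarith [hregret hω T i p hp]

lemma exists_expectationSupLE (hL : ∀ i, LipschitzWith L (grad ℓ i))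
    (hG : ∀ i x, ‖grad ℓ i x‖ ≤ G) (hz : ∀ x, 0 ≤ ∑ i, ⟪grad ℓ i x, x i - z i⟫_ℝ)
    (X₁ : Profile d) (σ : ℝ) {i : Fin N} {P : Set (EuclideanSpace ℝ (Fin (d i)))}
    (hP : Bornology.IsBounded P) :
    ∃ K, ∀ {Ω : Type*} [MeasurableSpace Ω] {μ : Measure Ω} [IsProbabilityMeasure μ]
      {q : ℝ} {ξ X x g : ℕ → Ω → Profile d}, IsNoisyPlay μ ℓ L G σ q X₁ ξ X x g → ∀ T c,
      1 + ∑ j, ∫ ω, √(energy (g · ω j) T) ∂μ ≤ c →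
      ExpectationSupLE μ P (fun p ω => linRegret ℓ i (x · ω) T p) (K * c) ∧
        ExpectationSupLE μ P (fun p ω => regret ℓ i (x · ω) T p) (K * c) := by
  obtain ⟨ρ, hρ, hPρ⟩ := hP.exists_pos_norm_le
  obtain ⟨K, hK, hregret⟩ := exists_linRegret_le_isCentered_add hL hG hz X₁ σ hρ.le
  refine ⟨K, fun {Ω _ μ _ q ξ X x g} H T c hc => ?_⟩
  obtain ⟨D, hD, hle⟩ := hregret H T i
  obtain ⟨henergy_int, henergy⟩ := H.integral_const_mul_one_add_sum_sqrt_energy K T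
  have hc0 : 0 ≤ c := hc.trans' <| add_nonneg zero_le_one <|
    Finset.sum_nonneg fun j _ => integral_nonneg fun _ => Real.sqrt_nonneg _
  refine H.expectationSupLE hρ.le hPρ (hD.1.add henergy_int) ?_ ?_ (by positivity)
  · filter_upwards [hle] with ω hω p hp using hω p (hPρ p hp)
  · rw [integral_add' hD.1 henergy_int, hD.2, henergy, zero_add]
    gcongr

end IsNoisyPlay

end Regret

section Rates

variable {N : ℕ} {d : Fin N → ℕ} {ℓ : Fin N → Profile d → ℝ} {L : ℝ≥0} {G : ℝ} {z : Profile d}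

namespace IsNoisyPlay

lemma exists_expectationSupLE_sqrt (hL : ∀ i, LipschitzWith L (grad ℓ i))
    (hG : ∀ i x, ‖grad ℓ i x‖ ≤ G) (hz : ∀ x, 0 ≤ ∑ i, ⟪grad ℓ i x, x i - z i⟫_ℝ)
    (X₁ : Profile d) (σ : ℝ) {i : Fin N} {P : Set (EuclideanSpace ℝ (Fin (d i)))}
    (hP : Bornology.IsBounded P) :
    ∃ C, ∀ {Ω : Type*} [MeasurableSpace Ω] {μ : Measure Ω} [IsProbabilityMeasure μ]
      {q : ℝ} {ξ X x g : ℕ → Ω → Profile d}, IsNoisyPlay μ ℓ L G σ q X₁ ξ X x g → ∀ T : ℕ,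
      ExpectationSupLE μ P (fun p ω => linRegret ℓ i (x · ω) T p) (C * √T) ∧
        ExpectationSupLE μ P (fun p ω => regret ℓ i (x · ω) T p) (C * √T) := by
  obtain ⟨K, hregret⟩ := exists_expectationSupLE hL hG hz X₁ σ hP
  set r := √(1 + (G + σ) ^ 2)
  refine ⟨K * (1 + N * r), fun {Ω _ μ _ q ξ X x g} H T => ?_⟩
  rcases T.eq_zero_or_pos with rfl | hT
  · simp [ExpectationSupLE, linRegret, regret, Set.finite_range_const.bddAbove]
  · have hone : 1 ≤ √T := Real.one_le_sqrt.2 (mod_cast hT)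
    have henergy : ∑ j, ∫ ω, √(energy (g · ω j) T) ∂μ ≤ N * (r * √T) := by
      simpa using Finset.sum_le_card_nsmul Finset.univ _ _
        fun j _ => H.integral_sqrt_energy_le_sqrt j hT
    rw [mul_assoc]
    exact hregret H T _ (by linarith)

lemma exists_expectationSupLE_exp (hL : ∀ i, LipschitzWith L (grad ℓ i))
    (hG : ∀ i x, ‖grad ℓ i x‖ ≤ G) (hz : ∀ x, 0 ≤ ∑ i, ⟪grad ℓ i x, x i - z i⟫_ℝ)
    (X₁ : Profile d) (σ σM : ℝ) {i : Fin N} {P : Set (EuclideanSpace ℝ (Fin (d i)))}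
    (hP : Bornology.IsBounded P) :
    ∃ A B, ∀ {Ω : Type*} [MeasurableSpace Ω] {μ : Measure Ω} [IsProbabilityMeasure μ]
      {q : ℝ} {ξ X x g : ℕ → Ω → Profile d}, IsNoisyPlay μ ℓ L G σ q X₁ ξ X x g →
      HasVarianceControl μ ℓ ξ x 0 σM → 0 < q → ∀ T : ℕ,
      ExpectationSupLE μ P (fun p ω => linRegret ℓ i (x · ω) T p)
          (A * Real.exp (B * (1 / (2 * q)))) ∧
        ExpectationSupLE μ P (fun p ω => regret ℓ i (x · ω) T p)
          (A * Real.exp (B * (1 / (2 * q)))) := by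
  obtain ⟨K, hK, hgain⟩ := exists_sum_integral_extrapolationGain_le hL hG hz X₁ σ
  obtain ⟨K', hregret⟩ := exists_expectationSupLE hL hG hz X₁ σ hP
  set b := (1 + σM ^ 2) * K + N * (1 + (G + σ) ^ 2) + 1
  have hb : 1 ≤ b := le_add_of_nonneg_left (by positivity)
  refine ⟨K' * (2 + 2 * N), Real.log (2 * b), fun {Ω _ μ _ q ξ X x g} H hξ hq T => ?_⟩
  have henergy := H.sum_integral_sqrt_energy_le hξ hq hK (hgain H T)
  have hone : 1 ≤ Real.exp (Real.log (2 * b) * (1 / (2 * q))) :=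
    Real.one_le_exp (mul_nonneg (Real.log_nonneg (by linarith)) (by positivity))
  rw [mul_assoc]
  exact hregret H T _ (by linarith)

end IsNoisyPlay

end Rates

end NoisyGame

open NoisyGame in
theorem mainTheorem3_general {N : ℕ} {d : Fin N → ℕ} (ℓ : Fin N → Profile d → ℝ) (L : ℝ≥0)
    (G σ σM : ℝ) (hℓ : IsSmoothConvexGame ℓ L) (z : Profile d)
    (hz : ∀ x, 0 ≤ ∑ i, ⟪grad ℓ i x, x i - z i⟫_ℝ) (hG : ∀ i x, ‖grad ℓ i x‖ ≤ G)
    (X₁ : Profile d) (i : Fin N) (P : Set (EuclideanSpace ℝ (Fin (d i))))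
    (hP : Bornology.IsBounded P) :
    (∃ C : ℝ, ∀ q : ℝ, q ≤ 1 / 4 →
      ∀ (Ω : Type*) [MeasurableSpace Ω] (μ : Measure Ω) [IsProbabilityMeasure μ]
        (ξ X x g : ℕ → Ω → Profile d),
      (∀ ω, IsAdaptiveOptDAPlus ℓ q X₁ (ξ · ω) (X · ω) (x · ω) (g · ω)) →
      IsUnbiasedBoundedNoise μ ξ x σ →
      ∀ T : ℕ,
        ExpectationSupLE μ P (fun p ω => linRegret ℓ i (x · ω) T p) (C * √T) ∧
        ExpectationSupLE μ P (fun p ω => regret ℓ i (x · ω) T p) (C * √T)) ∧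
    (∃ A B : ℝ, ∀ q : ℝ, 0 < q → q ≤ 1 / 4 →
      ∀ (Ω : Type*) [MeasurableSpace Ω] (μ : Measure Ω) [IsProbabilityMeasure μ]
        (ξ X x g : ℕ → Ω → Profile d),
      (∀ ω, IsAdaptiveOptDAPlus ℓ q X₁ (ξ · ω) (X · ω) (x · ω) (g · ω)) →
      IsUnbiasedBoundedNoise μ ξ x σ →
      HasVarianceControl μ ℓ ξ x 0 σM →
      ∀ T : ℕ,
        ExpectationSupLE μ P (fun p ω => linRegret ℓ i (x · ω) T p)
          (A * Real.exp (B * (1 / (2 * q)))) ∧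
        ExpectationSupLE μ P (fun p ω => regret ℓ i (x · ω) T p)
          (A * Real.exp (B * (1 / (2 * q))))) := by
  obtain ⟨C, hC⟩ := IsNoisyPlay.exists_expectationSupLE_sqrt hℓ.lipschitz hG hz X₁ σ (i := i) hP
  obtain ⟨A, B, hAB⟩ :=
    IsNoisyPlay.exists_expectationSupLE_exp hℓ.lipschitz hG hz X₁ σ σM (i := i) hP
  exact ⟨⟨C, fun q hq Ω _ μ _ ξ X x g hpath hnoise => hC ⟨hℓ, hG, hq, hpath, hnoise⟩⟩, A, B,
    fun q hq0 hq Ω _ μ _ ξ X x g hpath hnoise hξ => hAB ⟨hℓ, hG, hq, hpath, hnoise⟩ hξ hq0⟩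

open NoisyGame in
theorem mainTheorem3 {N : ℕ} {d : Fin N → ℕ} (ℓ : Fin N → Profile d → ℝ) (L : ℝ≥0) (G σ σM : ℝ)
    (hℓ : IsSmoothConvexGame ℓ L) (hVS : IsVariationallyStable ℓ)
    (hG : ∀ i x, ‖grad ℓ i x‖ ≤ G) (X₁ : Profile d)
    (i : Fin N) (P : Set (EuclideanSpace ℝ (Fin (d i)))) (hP : Bornology.IsBounded P) :
    (∃ C : ℝ, ∀ q : ℝ, 0 < q → q ≤ 1 / 4 →
      ∀ (Ω : Type*) [MeasurableSpace Ω] (μ : Measure Ω) [IsProbabilityMeasure μ]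
        (ξ X x g : ℕ → Ω → Profile d),
      (∀ ω, IsAdaptiveOptDAPlus ℓ q X₁ (ξ · ω) (X · ω) (x · ω) (g · ω)) →
      IsUnbiasedBoundedNoise μ ξ x σ →
      ∀ T : ℕ,
        SupExpectationLE μ P (fun p ω => linRegret ℓ i (x · ω) T p) (C * √T) ∧
        SupExpectationLE μ P (fun p ω => regret ℓ i (x · ω) T p) (C * √T)) ∧
    (∃ A B : ℝ, ∀ q : ℝ, 0 < q → q ≤ 1 / 4 →
      ∀ (Ω : Type*) [MeasurableSpace Ω] (μ : Measure Ω) [IsProbabilityMeasure μ]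
        (ξ X x g : ℕ → Ω → Profile d),
      (∀ ω, IsAdaptiveOptDAPlus ℓ q X₁ (ξ · ω) (X · ω) (x · ω) (g · ω)) →
      IsUnbiasedBoundedNoise μ ξ x σ →
      HasVarianceControl μ ℓ ξ x 0 σM →
      ∀ T : ℕ,
        ExpectationSupLE μ P (fun p ω => linRegret ℓ i (x · ω) T p)
          (A * Real.exp (B * (1 / (2 * q)))) ∧
        ExpectationSupLE μ P (fun p ω => regret ℓ i (x · ω) T p)
          (A * Real.exp (B * (1 / (2 * q))))) := by
  obtain ⟨z, hz⟩ := hVS.exists_nash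
  obtain ⟨⟨C, hC⟩, hAB⟩ := mainTheorem3_general ℓ L G σ σM hℓ z (hVS.stable · z hz) hG X₁ i P hP
  refine ⟨⟨C, fun q _ hq Ω _ μ _ ξ X x g hpath hnoise T => ?_⟩, hAB⟩
  have H : IsNoisyPlay μ ℓ L G σ q X₁ ξ X x g := ⟨hℓ, hG, hq, hpath, hnoise⟩
  obtain ⟨hlin, hreg⟩ := hC q hq Ω μ ξ X x g hpath hnoise T
  exact ⟨hlin.supExpectationLE fun p _ => H.integrable_linRegret i T p,
    hreg.supExpectationLE fun p _ => H.integrable_regret i T p⟩
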